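/- Let $\mathbb T=\mathbb R/\mathbb Z$ with Lebesgue measure $\lambda$, and for a real $\alpha$ let $Tx=x+\alpha$ on $\mathbb T$. Measurable functions $f,g:\mathbb T\to\mathbb R$ are called cohomologous if there is a measurable $j:\mathbb T\to\mathbb R$ with $f(x)-g(x)=j(x)-j(Tx)$ for almost every $x$. For a function $f:\mathbb T\to\mathbb R$ of bounded variation (normalised to be left-continuous), the jump of $f$ at $y$ is $f(y^+)-f(y^-)$. Let $\mathcal U$ be the set of all such $f$ whose Lebesgue decomposition has no singular continuous part, i.e. for which $x\mapsto f(x)-\sum_{0\le y<x}\bigl(f(y^+)-f(y^-)\bigr)$ is absolutely continuous on $[0,1]$, and whose sum of jumps $S(f)=\sum_{y\in\mathbb T}\bigl(f(y^+)-f(y^-)\bigr)$ is nonzero. A von Neumann function is a function $g:\mathbb T\to\mathbb R$ that is piecewise absolutely continuous, i.e. absolutely continuous on each of finitely many consecutive intervals with endpoints $0=a_0<a_1<\dots<a_N=1$ (the values at the endpoints $a_i$ being immaterial), and satisfies $\int_{\mathbb T}g'\,d\lambda\neq0$. Let $\alpha$ be irrational with bounded partial quotients. Let $f\in\mathcal U$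 have an infinite set of discontinuities $\{\beta_i\}_{i=1}^{\infty}\subset\mathbb Q$ with $\beta_i-\beta_j\notin\mathbb Z+\mathbb Z\alpha$ whenever $i\ne j$, let the jump $d_i$ of $f$ at $\beta_i$ be positive for every $i$, and suppose that for every $\epsilon>0$ there is $N_\epsilon\ge1$ with $$\sum_{i>N_\epsilon}d_i\le\epsilon\,\min\{d_1,\dots,d_{N_\epsilon}\}.$$ Then $f$ is not cohomologous to any von Neumann function. In particular, for every irrational $\alpha$ with bounded partial quotients there is a function $f\in\mathcal U$ that is not cohomologous to any von Neumann function. -/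

import Mathlib

open Set MeasureTheory

noncomputable section

/-- The `1`-periodic function on the real line given by a function on the circle `𝕋 = ℝ/ℤ`. -/
def circleLift (f : UnitAddCircle → ℝ) : ℝ → ℝ := fun x => f (x : UnitAddCircle)

/-- `α` has bounded partial quotients: with `α = [a₀; a₁, a₂, …]`, the sequence `a₁, a₂, …` is
bounded. -/
def HasBoundedPartialQuotients (α : ℝ) : Prop :=
  ∃ C : ℝ, ∀ (n : ℕ) (a : ℝ), (GenContFract.of α).partDens.get? n = some a → a ≤ C

/-- The jump `f(y⁺) - f(y⁻)` of a function on the circle at the point `y mod 1`. -/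
def circleJump (f : UnitAddCircle → ℝ) (y : ℝ) : ℝ :=
  Function.rightLim (circleLift f) y - Function.leftLim (circleLift f) y

/-- Functions of bounded variation on the circle, normalised to be continuous from the left. -/
structure IsCircleBV (f : UnitAddCircle → ℝ) : Prop where
  boundedVariation : BoundedVariationOn (circleLift f) (Icc 0 1)
  leftContinuous : ∀ x : ℝ, ContinuousWithinAt (circleLift f) (Iic x) x

/-- The jump part `f_j(x) = ∑_{0 ≤ y < x} (f(y⁺) - f(y⁻))`, `x ∈ [0, 1]`, in the Lebesgue
decomposition of a left-continuous function of bounded variation. -/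
def jumpPart (f : UnitAddCircle → ℝ) (x : ℝ) : ℝ :=
  ∑' y : Ico (0 : ℝ) x, circleJump f y

/-- The space `BV_{a+j}(𝕋)`: functions of bounded variation whose Lebesgue decomposition has no
singular continuous part, that is, `f - f_j` (which is `f_a + f_s`, both determined up to
constants) is absolutely continuous on `[0, 1]`.  By left-continuity on the circle, `circleLift f`
restricted to `[0, 1]` takes at `1` the value `lim_{x → 1⁻} f(x)`. -/
structure IsBVaj (f : UnitAddCircle → ℝ) : Prop extends IsCircleBV f where
  noSingularPart :
    AbsolutelyContinuousOnInterval (fun x => circleLift f x - jumpPart f x) 0 1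

/-- The sum `S(f)` of all jumps of `f` on the circle. -/
def sumOfJumps (f : UnitAddCircle → ℝ) : ℝ :=
  ∑' y : Ico (0 : ℝ) 1, circleJump f y

/-- The class `𝒰` of the functions in `BV_{a+j}(𝕋)` with nonzero sum of jumps. -/
structure IsClassU (f : UnitAddCircle → ℝ) : Prop extends IsBVaj f where
  sumOfJumps_ne_zero : sumOfJumps f ≠ 0

/-- Piecewise absolutely continuous functions on the circle: for some
`0 = a₀ < a₁ < ⋯ < a_N = 1`, the function is absolutely continuous on each piece, i.e. agrees
inside the piece with an absolutely continuous function on `[aᵢ, aᵢ₊₁]`.  The values at the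
finitely many points `aᵢ` are left free, so that both the right-continuous functions (pieces
`[aᵢ, aᵢ₊₁)`) and the left-continuous ones (pieces `(aᵢ, aᵢ₊₁]`) are covered. -/
def IsPiecewiseAC (g : UnitAddCircle → ℝ) : Prop :=
  ∃ (N : ℕ) (a : ℕ → ℝ), a 0 = 0 ∧ a N = 1 ∧ ∀ i < N, a i < a (i + 1) ∧
    ∃ G : ℝ → ℝ, AbsolutelyContinuousOnInterval G (a i) (a (i + 1)) ∧
      EqOn (circleLift g) G (Ioo (a i) (a (i + 1)))

/-- Von Neumann's functions: piecewise absolutely continuous with `∫_𝕋 g' dλ ≠ 0`. -/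
structure IsVonNeumann (g : UnitAddCircle → ℝ) : Prop where
  piecewiseAC : IsPiecewiseAC g
  integral_deriv_ne_zero : (∫ x in (0 : ℝ)..1, deriv (circleLift g) x) ≠ 0

/-- `f` is a coboundary for the rotation `T x = x + α`: `f = j - j ∘ T` almost everywhere for some
measurable `j`. -/
def IsCoboundary (α : ℝ) (f : UnitAddCircle → ℝ) : Prop :=
  ∃ j : UnitAddCircle → ℝ, Measurable j ∧
    ∀ᵐ x : UnitAddCircle, f x = j x - j (x + (α : UnitAddCircle))

/-- Two functions are cohomologous (over the rotation by `α`) if they differ by a coboundary. -/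
def IsCohomologous (α : ℝ) (f g : UnitAddCircle → ℝ) : Prop :=
  IsCoboundary α (fun x => f x - g x)

/-- The tail condition: for every `ε > 0` there is `N ≥ 1` such that the sum of all terms after the
first `N` is at most `ε` times the minimum of the first `N` terms `d 0, …, d (N - 1)`. -/
def TailCondition (d : ℕ → ℝ) : Prop :=
  ∀ ε : ℝ, 0 < ε → ∃ N : ℕ, 1 ≤ N ∧ ∀ i < N, ∑' k : ℕ, d (N + k) ≤ ε * d i

end

open Filter Topology

/-! Suppose `h = f - g` equals `j - j ∘ T`. Birkhoff sums telescope: `h_n(x) = j(x) - j(x + nα)`.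
With `u = exp(itj)`, the integral of `|exp(it h_n) - 1|` equals that of `|u(x) - u(x + nα)|`, which
is arbitrarily small once `‖nα‖` is small, because translations are continuous in mean. The
contradiction is a positive lower bound for the same integral, uniform in `n`.

Keep the first `N` jump points `b_i`, let `δ` be the smallest of their jumps, and take `N` larger
than the number of breakpoints of `g` and so large that the remaining jumps add up to at most `δ/4`.
The points `b_i - kα` with `i < N`, `k < n` are `ρ/n`-separated (`exists_separation`): rationality
of the `b_i` reduces this to bad approximability of `α`. There are `Nn` of them, while the backward
orbits of the breakpoints of `g` spoil at most `(N - 1)n`, so at least `n` survive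
(`exists_finset_away`). Across a surviving point `h_n` jumps by `d_i ≥ δ`, up to errors from the
absolutely continuous parts and from the small jumps. For each fixed `k` the windows around the
translated points are disjoint, so their errors add up to at most the mass of an error measure on a
small set, at most `3δ/8` (`sum_abs_birkhoffSum_sub_le`).

Thus at distance `s` on the two sides of the surviving points, `|exp(it h_n) - 1|` sums to at least
a constant times `n`. Integrating over `s` up to a constant over `n` gives the lower bound
(`not_isCoboundary_of_increments`).

For existence, a series of sawtooth functions with factorially small weights has all the required
properties. -/

/-! ### Continued fractions: bounded partial quotients imply bad approximability. -/

theorem GenContFract.exists_int_contsAux (ξ : ℝ) (n : ℕ) :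
    ∃ A B : ℤ, ((GenContFract.of ξ).contsAux n).a = A ∧ ((GenContFract.of ξ).contsAux n).b = B := by
  induction n using Nat.strong_induction_on with
  | _ n ih =>
    match n with
    | 0 => exact ⟨1, 0, by simp [GenContFract.contsAux], by simp [GenContFract.contsAux]⟩
    | 1 => exact ⟨⌊ξ⌋, 1, by simp [GenContFract.contsAux, GenContFract.of_h_eq_floor],
        by simp [GenContFract.contsAux]⟩
    | n + 2 =>
      obtain ⟨A₀, B₀, hA₀, hB₀⟩ := ih n (by omega)
      obtain ⟨A₁, B₁, hA₁, hB₁⟩ := ih (n + 1) (by omega)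
      rcases hs : (GenContFract.of ξ).s.get? n with _ | gp
      · exact ⟨A₁, B₁, by rw [← hA₁]; simp [GenContFract.contsAux, hs],
          by rw [← hB₁]; simp [GenContFract.contsAux, hs]⟩
      · obtain ⟨ha, z, hz⟩ := GenContFract.of_partNum_eq_one_and_exists_int_partDen_eq hs
        refine ⟨z * A₁ + A₀, z * B₁ + B₀, ?_, ?_⟩
        · rw [GenContFract.contsAux_recurrence hs rfl rfl]
          simp [ha, hz, hA₀, hA₁]
        · rw [GenContFract.contsAux_recurrence hs rfl rfl]
          simp [ha, hz, hB₀, hB₁]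

theorem GenContFract.not_terminatedAt_of_irrational {ξ : ℝ} (hξ : Irrational ξ) (n : ℕ) :
    ¬ (GenContFract.of ξ).TerminatedAt n := by
  intro h
  obtain ⟨q, hq⟩ := (GenContFract.terminates_iff_rat ξ).1 ⟨n, h⟩
  exact hξ ⟨q, hq.symm⟩

/-- The determinant identity makes numerator and denominator of a convergent coprime, so the
denominator divides that of any fraction of the same value. -/
theorem GenContFract.dens_le_den {ξ : ℝ} (hξ : Irrational ξ) {n : ℕ} {q : ℚ}
    (hq : (GenContFract.of ξ).convs n = q) : (GenContFract.of ξ).dens n ≤ q.den := by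
  obtain ⟨A, B, hA, hB⟩ := GenContFract.exists_int_contsAux ξ (n + 1)
  obtain ⟨A', B', hA', hB'⟩ := GenContFract.exists_int_contsAux ξ (n + 2)
  have hdet := (SimpContFract.of ξ).determinant (n := n)
    (GenContFract.not_terminatedAt_of_irrational hξ n)
  have hA1 : (GenContFract.of ξ).nums n = A := hA
  have hB1 : (GenContFract.of ξ).dens n = B := hB
  have hA2 : (GenContFract.of ξ).nums (n + 1) = A' := hA'
  have hB2 : (GenContFract.of ξ).dens (n + 1) = B' := hB'
  change (GenContFract.of ξ).nums n * (GenContFract.of ξ).dens (n + 1) -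
    (GenContFract.of ξ).dens n * (GenContFract.of ξ).nums (n + 1) = _ at hdet
  rw [hA1, hB1, hA2, hB2] at hdet
  have hdet' : A * B' - B * A' = (-1) ^ (n + 1) := by exact_mod_cast hdet
  have hconv : (GenContFract.of ξ).convs n = A / B := by
    rw [GenContFract.conv_eq_num_div_den, hA1, hB1]
  rw [hB1]
  have hB0 : (B : ℝ) ≠ 0 := by
    have h := GenContFract.succ_nth_fib_le_of_nth_den (v := ξ) (n := n)
      (Or.inr (GenContFract.not_terminatedAt_of_irrational hξ _))
    rw [hB1] at h
    have : (0 : ℝ) < Nat.fib (n + 1) := by exact_mod_cast Nat.fib_pos.2 n.succ_pos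
    linarith
  have hcross : q.num * B = A * q.den := by
    have h1 : (A : ℝ) / B = q := by rw [← hconv, hq]
    rw [Rat.cast_def, div_eq_div_iff hB0 (by exact_mod_cast q.den_ne_zero)] at h1
    exact_mod_cast h1.symm
  have hsq : ((-1 : ℤ) ^ (n + 1)) * (-1) ^ (n + 1) = 1 := by rw [← mul_pow]; norm_num
  have hdvd : B ∣ (q.den : ℤ) := by
    refine ⟨(-1) ^ (n + 1) * (q.num * B' - q.den * A'), ?_⟩
    linear_combination (-(q.den : ℤ)) * hsq - (-1) ^ (n + 1) * (q.den : ℤ) * hdet' -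
      (-1) ^ (n + 1) * B' * hcross
  exact_mod_cast Int.le_of_dvd (by exact_mod_cast q.den_pos) hdvd

/-- The error of the `n`-th convergent is `±1 / (B (B / fr + B'))` with `B' ≤ B` the preceding
denominator. Since `⌊1 / fr⌋` is the next partial quotient, `1 / fr ≤ C + 1`, whence the constant `1
/ (C + 2)`. -/
theorem HasBoundedPartialQuotients.exists_le_abs_sub_convs {ξ : ℝ} (hξ : Irrational ξ)
    (h : HasBoundedPartialQuotients ξ) :
    ∃ c : ℝ, 0 < c ∧ ∀ n : ℕ,
      c / (GenContFract.of ξ).dens n ^ 2 ≤ |ξ - (GenContFract.of ξ).convs n| := by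
  obtain ⟨C, hC⟩ := h
  have hnt := GenContFract.not_terminatedAt_of_irrational hξ
  have key : ∀ n, ∃ ifp, GenContFract.IntFractPair.stream ξ n = some ifp ∧ 0 < ifp.fr ∧
      ifp.fr⁻¹ ≤ C + 1 := by
    intro n
    obtain ⟨gp, hgp⟩ := Option.ne_none_iff_exists'.1 (hnt n)
    obtain ⟨p', hp', hb⟩ :=
      GenContFract.IntFractPair.exists_succ_get?_stream_of_gcf_of_get?_eq_some hgp
    obtain ⟨p, hp, hfr, hof⟩ := GenContFract.IntFractPair.succ_nth_stream_eq_some_iff.1 hp'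
    refine ⟨p, hp, lt_of_le_of_ne (GenContFract.IntFractPair.nth_stream_fr_nonneg hp) hfr.symm, ?_⟩
    have h1 : gp.b ≤ C := hC n _ (GenContFract.partDen_eq_s_b hgp)
    rw [← hb, ← hof] at h1
    have h2 : (⌊p.fr⁻¹⌋ : ℝ) ≤ C := h1
    linarith [Int.lt_floor_add_one p.fr⁻¹]
  have hC0 : 0 < C + 1 := by
    obtain ⟨p, -, h1, h2⟩ := key 0
    exact lt_of_lt_of_le (inv_pos.2 h1) h2
  refine ⟨1 / (C + 2), by apply one_div_pos.2; linarith, fun n => ?_⟩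
  obtain ⟨p, hp, hfr, hle⟩ := key n
  have hsub := GenContFract.sub_convs_eq hp
  simp only [hfr.ne', if_false] at hsub
  rw [hsub]
  set B := ((GenContFract.of ξ).contsAux (n + 1)).b with hB
  have hdens : (GenContFract.of ξ).dens n = B := rfl
  have hBpos : 0 < B := by
    have h := GenContFract.succ_nth_fib_le_of_nth_den (v := ξ) (n := n) (Or.inr (hnt _))
    have : (0 : ℝ) < Nat.fib (n + 1) := by exact_mod_cast Nat.fib_pos.2 n.succ_pos
    rw [← hdens]; linarith
  have hpB : ((GenContFract.of ξ).contsAux n).b ≤ B := by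
    rcases n with - | n
    · simpa using hBpos.le
    · exact GenContFract.of_den_mono
  have hpB0 : 0 ≤ ((GenContFract.of ξ).contsAux n).b := GenContFract.zero_le_of_contsAux_b
  have hfr' := inv_pos.2 hfr
  rw [hdens, abs_div, abs_neg_one_pow, abs_of_pos (by positivity), div_div]
  refine one_div_le_one_div_of_le (by positivity) ?_
  nlinarith [mul_le_mul_of_nonneg_right hle hBpos.le]

/-- Irrational numbers with bounded partial quotients are badly approximable. -/
theorem HasBoundedPartialQuotients.exists_le_norm_nat_mul {α : ℝ} (hα : Irrational α)
    (h : HasBoundedPartialQuotients α) :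
    ∃ c : ℝ, 0 < c ∧ ∀ k : ℕ, 0 < k → c / k ≤ ‖((k * α : ℝ) : UnitAddCircle)‖ := by
  obtain ⟨c, hc, hconv⟩ := h.exists_le_abs_sub_convs hα
  have hrat : ∀ q : ℚ, min c (1 / 2) / (q.den : ℝ) ^ 2 ≤ |α - q| := by
    intro q
    have hden : (0 : ℝ) < q.den := by exact_mod_cast q.den_pos
    -- By Legendre's theorem a rational this close is a convergent; any other satisfies the bound
    -- with constant `1/2`.
    by_cases hq : |α - q| < 1 / (2 * (q.den : ℝ) ^ 2)
    · obtain ⟨n, hn⟩ := Real.exists_convs_eq_rat hq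
      rw [← hn]
      refine le_trans ?_ (hconv n)
      have h1 := GenContFract.dens_le_den hα hn
      have h2 : 0 < (GenContFract.of α).dens n := by
        have h := GenContFract.succ_nth_fib_le_of_nth_den (v := α) (n := n)
          (Or.inr (GenContFract.not_terminatedAt_of_irrational hα _))
        have : (0 : ℝ) < Nat.fib (n + 1) := by exact_mod_cast Nat.fib_pos.2 n.succ_pos
        linarith
      gcongr
      exact min_le_left _ _
    · refine le_trans ?_ (not_lt.1 hq)
      rw [← div_div]
      gcongr
      exact min_le_right _ _
  refine ⟨min c (1 / 2), by positivity, fun k hk => ?_⟩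
  have hk' : (0 : ℝ) < k := by exact_mod_cast hk
  rw [UnitAddCircle.norm_eq]
  set r := round ((k : ℝ) * α)
  have h1 := hrat ((r : ℚ) / (k : ℚ))
  have hd : ((((r : ℚ) / (k : ℚ)).den : ℕ) : ℝ) ≤ k := by
    have : (((((r : ℚ) / (k : ℚ)).den : ℕ) : ℤ)) ∣ (k : ℤ) := by
      exact_mod_cast Rat.den_dvd r (k : ℤ)
    exact_mod_cast Int.le_of_dvd (by exact_mod_cast hk) this
  have hd0 : (0 : ℝ) < (((r : ℚ) / (k : ℚ)).den : ℕ) := by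
    exact_mod_cast ((r : ℚ) / (k : ℚ)).den_pos
  have h2 : |(k : ℝ) * α - r| = k * |α - ((((r : ℚ) / (k : ℚ)) : ℚ) : ℝ)| := by
    rw [← abs_of_pos hk', ← abs_mul, abs_of_pos hk']
    congr 1
    push_cast
    field_simp
  rw [h2]
  calc min c (1 / 2) / k = k * (min c (1 / 2) / (k : ℝ) ^ 2) := by field_simp
    _ ≤ k * (min c (1 / 2) / ((((r : ℚ) / (k : ℚ)).den : ℕ) : ℝ) ^ 2) := by gcongr
    _ ≤ _ := by gcongr

/-! ### Separation of the orbit points -/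

theorem Rat.inv_le_norm_coe_unitAddCircle {r : ℚ} {Q : ℕ} (hQ : 0 < Q) (h : (r.den : ℕ) ∣ Q)
    (hr : ∀ z : ℤ, r ≠ z) : (1 : ℝ) / Q ≤ ‖((r : ℝ) : UnitAddCircle)‖ := by
  rw [UnitAddCircle.norm_eq]
  set z := round (r : ℝ)
  have hQ' : (0 : ℝ) < Q := by exact_mod_cast hQ
  obtain ⟨e, he⟩ := h
  have h1 : (Q : ℚ) * r = ((e * r.num : ℤ) : ℚ) := by
    rw [he]; push_cast
    have := Rat.den_mul_eq_num r
    linear_combination (e : ℚ) * this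
  have h2 : (e * r.num - Q * z : ℤ) ≠ 0 := by
    intro h0
    apply hr z
    have h3 : (Q : ℚ) * r = Q * z := by
      rw [h1]; exact_mod_cast sub_eq_zero.1 h0
    exact mul_left_cancel₀ (by exact_mod_cast hQ.ne') h3
  have h4 : (1 : ℝ) ≤ |((e * r.num - Q * z : ℤ) : ℝ)| := by
    exact_mod_cast Int.one_le_abs h2
  have h5 : ((e * r.num - Q * z : ℤ) : ℝ) = Q * ((r : ℝ) - z) := by
    have : (Q : ℝ) * r = ((e * r.num : ℤ) : ℝ) := by exact_mod_cast h1
    rw [mul_sub, this]; push_cast; ring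
  rw [h5, abs_mul, abs_of_pos hQ'] at h4
  rwa [div_le_iff₀' hQ']

theorem Rat.nsmul_coe_unitAddCircle_eq_zero {r : ℚ} {Q : ℕ} (h : r.den ∣ Q) :
    Q • ((r : ℝ) : UnitAddCircle) = 0 := by
  obtain ⟨e, rfl⟩ := h
  rw [← AddCircle.coe_nsmul, AddCircle.coe_eq_zero_iff]
  refine ⟨e * r.num, ?_⟩
  have h1 : (r.den : ℝ) * r = r.num := by exact_mod_cast Rat.den_mul_eq_num r
  simp only [zsmul_eq_mul, nsmul_eq_mul]
  push_cast
  linear_combination -(e : ℝ) * h1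

/-- For equal `k` the difference is a non-integral rational with bounded denominator. For different
`k`, multiplying by a common denominator `Q` kills the rational part and leaves a multiple of `α`,
to which bad approximability applies. -/
theorem exists_separation {α c : ℝ} (hc : 0 < c)
    (hα : ∀ k : ℕ, 0 < k → c / k ≤ ‖((k * α : ℝ) : UnitAddCircle)‖)
    {N : ℕ} (b : Fin N → ℚ) (hb : ∀ i j, i ≠ j → ∀ z : ℤ, b i - b j ≠ z) :
    ∃ ρ : ℝ, 0 < ρ ∧ ∀ n : ℕ, ∀ p q : Fin N × Fin n, p ≠ q →
      ρ / n ≤ ‖((((b p.1 : ℝ) : UnitAddCircle) - (p.2 : ℕ) • (α : UnitAddCircle)) -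
        (((b q.1 : ℝ) : UnitAddCircle) - (q.2 : ℕ) • (α : UnitAddCircle)))‖ := by
  classical
  set D : ℕ := ∏ i, (b i).den with hD
  -- The square makes `Q` a multiple of the denominators of the differences `b i - b j`.
  set Q : ℕ := D * D with hQ
  have hDpos : 0 < D := Finset.prod_pos fun i _ => (b i).den_pos
  have hQpos : 0 < Q := Nat.mul_pos hDpos hDpos
  have hdvd : ∀ i, (b i).den ∣ D := fun i => Finset.dvd_prod_of_mem _ (Finset.mem_univ i)
  have hQ' : (0 : ℝ) < Q := by exact_mod_cast hQpos
  refine ⟨min (1 / Q) (c / Q / Q), by positivity, ?_⟩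
  rintro n ⟨i, k⟩ ⟨j, l⟩ hne
  have hn : 0 < n := lt_of_le_of_lt (Nat.zero_le _) k.2
  have hn' : (0 : ℝ) < n := by exact_mod_cast hn
  have hn1 : (1 : ℝ) ≤ n := by exact_mod_cast hn
  by_cases hkl : k = l
  · subst hkl
    have hij : i ≠ j := fun h => hne (by rw [h])
    have h1 := Rat.inv_le_norm_coe_unitAddCircle (r := b i - b j) hQpos
      ((Rat.sub_den_dvd _ _).trans (mul_dvd_mul (hdvd i) (hdvd j))) (hb i j hij)
    have h2 : (((b i : ℝ) : UnitAddCircle) - (k : ℕ) • (α : UnitAddCircle)) -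
        (((b j : ℝ) : UnitAddCircle) - (k : ℕ) • (α : UnitAddCircle)) =
        (((b i - b j : ℚ) : ℝ) : UnitAddCircle) := by
      rw [Rat.cast_sub, AddCircle.coe_sub, sub_sub_sub_cancel_right]
    rw [h2]
    refine le_trans ?_ h1
    calc min (1 / (Q : ℝ)) (c / Q / Q) / n ≤ (1 / Q) / n := by gcongr; exact min_le_left _ _
      _ ≤ 1 / Q := div_le_self (by positivity) hn1
  · have key : ∀ i j, ∀ k l : ℕ, k < l → l < n →
        c / Q / Q / n ≤ ‖(((b i : ℝ) : UnitAddCircle) - k • (α : UnitAddCircle)) -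
        (((b j : ℝ) : UnitAddCircle) - l • (α : UnitAddCircle))‖ := by
      intro i j k l hkl hl
      set x := (((b i : ℝ) : UnitAddCircle) - k • (α : UnitAddCircle)) -
        (((b j : ℝ) : UnitAddCircle) - l • (α : UnitAddCircle)) with hx
      obtain ⟨e, rfl⟩ := Nat.exists_eq_add_of_lt hkl
      have hQx : Q • x = ((((Q * (e + 1) : ℕ) : ℝ) * α : ℝ) : UnitAddCircle) := by
        have hbi := Rat.nsmul_coe_unitAddCircle_eq_zero ((hdvd i).trans (Dvd.intro D hQ.symm))
        have hbj := Rat.nsmul_coe_unitAddCircle_eq_zero ((hdvd j).trans (Dvd.intro D hQ.symm))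
        have hx' : x = (((b i : ℝ) : UnitAddCircle) - ((b j : ℝ) : UnitAddCircle)) +
            (e + 1) • (α : UnitAddCircle) := by
          rw [hx, add_assoc, add_smul]; abel
        rw [hx', smul_add, smul_sub, hbi, hbj, sub_zero, zero_add, ← mul_smul,
          ← nsmul_eq_mul, AddCircle.coe_nsmul]
      have h1 := hα (Q * (e + 1)) (by positivity)
      rw [← hQx] at h1
      have h2 : ‖Q • x‖ ≤ Q * ‖x‖ := norm_nsmul_le
      have h3 : c / (Q * n) ≤ c / ((Q * (e + 1) : ℕ) : ℝ) := by
        have : ((e + 1 : ℕ) : ℝ) ≤ n := by exact_mod_cast (by omega : e + 1 ≤ n)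
        push_cast at this ⊢
        gcongr
      have h4 : c / (Q * n) ≤ Q * ‖x‖ := h3.trans (h1.trans h2)
      rw [← div_le_iff₀' hQ'] at h4
      refine le_trans (le_of_eq ?_) h4
      field_simp
    have hle : min (1 / (Q : ℝ)) (c / Q / Q) / n ≤ c / Q / Q / n := by
      gcongr; exact min_le_right _ _
    refine hle.trans ?_
    rcases lt_or_gt_of_ne (fun h => hkl (Fin.ext h) : (k : ℕ) ≠ l) with h | h
    · exact key i j k l h l.2
    · rw [norm_sub_rev]
      exact key j i l k h k.2

/-! ### Translations are continuous in mean -/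

/-- Approximate `u` in `L¹` by a continuous function, which is uniformly continuous on the compact
circle; Haar measure is translation invariant. -/
theorem exists_lintegral_enorm_sub_translate_lt {u : UnitAddCircle → ℂ} (hu : Integrable u)
    {ε : ℝ} (hε : 0 < ε) :
    ∃ δ > 0, ∀ y : UnitAddCircle, ‖y‖ < δ → ∫⁻ x, ‖u x - u (x + y)‖ₑ < ENNReal.ofReal ε := by
  obtain ⟨v, hv, -⟩ := hu.exists_boundedContinuous_lintegral_sub_le
    (ε := ENNReal.ofReal (ε / 4)) (by simpa using hε)
  have huc : UniformContinuous v := CompactSpace.uniformContinuous_of_continuous v.continuous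
  obtain ⟨δ, hδ, h⟩ := Metric.uniformContinuous_iff.1 huc (ε / 4) (by positivity)
  refine ⟨δ, hδ, fun y hy => ?_⟩
  have hm : AEMeasurable (fun x => ‖u x - v x‖ₑ) :=
    (hu.aestronglyMeasurable.sub v.continuous.aestronglyMeasurable).enorm
  have hc : ∀ x, ‖v x - v (x + y)‖ₑ ≤ ENNReal.ofReal (ε / 4) := by
    intro x
    rw [← ofReal_norm]
    refine ENNReal.ofReal_le_ofReal (le_of_lt ?_)
    rw [← dist_eq_norm]
    exact h (by rw [dist_eq_norm, sub_add_cancel_left, norm_neg]; exact hy)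
  have htr : ∫⁻ x, ‖u (x + y) - v (x + y)‖ₑ ≤ ENNReal.ofReal (ε / 4) := by
    rw [lintegral_add_right_eq_self (fun x => ‖u x - v x‖ₑ) y]; exact hv
  calc ∫⁻ x, ‖u x - u (x + y)‖ₑ
      ≤ ∫⁻ x, (‖u x - v x‖ₑ + (ENNReal.ofReal (ε / 4) + ‖u (x + y) - v (x + y)‖ₑ)) := by
        refine lintegral_mono fun x => ?_
        have h1 : u x - u (x + y) =
            (u x - v x) + ((v x - v (x + y)) - (u (x + y) - v (x + y))) := by ring
        calc ‖u x - u (x + y)‖ₑ ≤ ‖u x - v x‖ₑ + ‖(v x - v (x + y)) - (u (x + y) - v (x + y))‖ₑ := by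
              rw [h1]; exact enorm_add_le _ _
          _ ≤ _ := by
              gcongr
              exact (enorm_sub_le).trans (by gcongr; exact hc x)
    _ = (∫⁻ x, ‖u x - v x‖ₑ) + ((∫⁻ _ : UnitAddCircle, ENNReal.ofReal (ε / 4)) +
          ∫⁻ x, ‖u (x + y) - v (x + y)‖ₑ) := by
        rw [lintegral_add_left' hm, lintegral_add_left measurable_const]
    _ ≤ ENNReal.ofReal (ε / 4) + (ENNReal.ofReal (ε / 4) + ENNReal.ofReal (ε / 4)) := by
        gcongr
        simp
    _ < ENNReal.ofReal ε := by
        rw [← ENNReal.ofReal_add (by positivity) (by positivity),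
          ← ENNReal.ofReal_add (by positivity) (by positivity)]
        exact (ENNReal.ofReal_lt_ofReal_iff hε).2 (by linarith)

/-! ### Elementary inequalities for `x ↦ ‖exp (i x) - 1‖` -/

theorem norm_exp_sub_one_sub_le (x y : ℝ) :
    ‖Complex.exp (Complex.I * (x - y : ℝ)) - 1‖ ≤
      ‖Complex.exp (Complex.I * x) - 1‖ + ‖Complex.exp (Complex.I * y) - 1‖ := by
  have h : Complex.exp (Complex.I * x) =
      Complex.exp (Complex.I * (x - y : ℝ)) * Complex.exp (Complex.I * y) := by
    rw [← Complex.exp_add]; congr 1; push_cast; ring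
  have h1 : ‖Complex.exp (Complex.I * y)‖ = 1 := by
    rw [mul_comm]; exact Complex.norm_exp_ofReal_mul_I y
  calc ‖Complex.exp (Complex.I * (x - y : ℝ)) - 1‖
      = ‖(Complex.exp (Complex.I * (x - y : ℝ)) - 1) * Complex.exp (Complex.I * y)‖ := by
        rw [norm_mul, h1, mul_one]
    _ = ‖(Complex.exp (Complex.I * x) - 1) - (Complex.exp (Complex.I * y) - 1)‖ := by
        rw [h]; congr 1; ring
    _ ≤ _ := norm_sub_le _ _

/-- If `x - y` is nearly `d`, then `exp (ix)` and `exp (iy)` cannot both be near `1`: for `0 ≤ d ≤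
π`, `|exp (id) - 1| = 2 sin (d/2) ≥ 2d/π ≥ d/2`. -/
theorem le_norm_exp_sub_one_add (x y d : ℝ) (hd : 0 ≤ d) (hd' : d ≤ Real.pi) :
    d / 2 - |x - y - d| ≤
      ‖Complex.exp (Complex.I * x) - 1‖ + ‖Complex.exp (Complex.I * y) - 1‖ := by
  have h1 := norm_exp_sub_one_sub_le x y
  have h2 := norm_exp_sub_one_sub_le (x - y) (x - y - d)
  rw [show x - y - (x - y - d) = d by ring] at h2
  have h3 : ‖Complex.exp (Complex.I * (x - y - d : ℝ)) - 1‖ ≤ |x - y - d| :=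
    Real.norm_exp_I_mul_ofReal_sub_one_le
  have h4 : d / 2 ≤ ‖Complex.exp (Complex.I * d) - 1‖ := by
    rw [Complex.norm_exp_I_mul_ofReal_sub_one]
    have h5 := Real.mul_le_sin (x := d / 2) (by linarith) (by linarith)
    have h6 : (1 : ℝ) / 2 ≤ 2 / Real.pi := by
      rw [div_le_div_iff₀ two_pos Real.pi_pos]; linarith [Real.pi_le_four]
    refine le_trans ?_ (Real.le_norm_self _)
    nlinarith
  linarith

/-! ### Iterating the coboundary equation -/

theorem IsCoboundary.exists_birkhoffSum {α : ℝ} {h : UnitAddCircle → ℝ} (hh : IsCoboundary α h) :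
    ∃ j : UnitAddCircle → ℝ, Measurable j ∧ ∀ n : ℕ, ∀ᵐ x : UnitAddCircle,
      ∑ k ∈ Finset.range n, h (x + k • (α : UnitAddCircle)) =
        j x - j (x + n • (α : UnitAddCircle)) := by
  obtain ⟨j, hj, hae⟩ := hh
  refine ⟨j, hj, fun n => ?_⟩
  have h1 : ∀ k : ℕ, ∀ᵐ x : UnitAddCircle, h (x + k • (α : UnitAddCircle)) =
      j (x + k • (α : UnitAddCircle)) - j (x + (k + 1) • (α : UnitAddCircle)) := by
    intro k
    have := (measurePreserving_add_right (volume : Measure UnitAddCircle)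
      (k • (α : UnitAddCircle))).quasiMeasurePreserving.ae hae
    filter_upwards [this] with x hx
    rw [hx, succ_nsmul, add_assoc]
  filter_upwards [ae_all_iff.2 h1] with x hx
  rw [Finset.sum_congr rfl fun k _ => hx k, Finset.sum_range_sub'
    (fun k => j (x + k • (α : UnitAddCircle)))]
  simp

/-! ### Averaging over separated points: the lower bound. -/

/-- Among separated points, indexed by `Fin N × Fin n`, at least `n` stay away from the backward
orbit of length `n` of fewer than `N` points. -/
theorem exists_finset_away {N n : ℕ} {a : UnitAddCircle} {P : Fin N × Fin n → UnitAddCircle}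
    {Γ : Finset UnitAddCircle} (hΓ : Γ.card < N) {r : ℝ}
    (hsep : ∀ p q, p ≠ q → r ≤ ‖P p - P q‖) :
    ∃ G : Finset (Fin N × Fin n), n ≤ G.card ∧
      ∀ p ∈ G, ∀ γ ∈ Γ, ∀ l < n, r / 2 ≤ ‖P p + l • a - γ‖ := by
  classical
  set G : Finset (Fin N × Fin n) :=
    Finset.univ.filter fun p => ∀ γ ∈ Γ, ∀ l < n, r / 2 ≤ ‖P p + l • a - γ‖ with hG
  refine ⟨G, ?_, fun p hp => (Finset.mem_filter.1 hp).2⟩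
  -- By separation, each pair `(γ, l)` is within `r / 2` for at most one point, so at most `(N - 1)
  -- * n` points are bad.
  have hbad : (Gᶜ).card ≤ (Γ ×ˢ Finset.range n).card := by
    refine Finset.card_le_card_of_forall_subsingleton
      (fun p q => ‖P p + q.2 • a - q.1‖ < r / 2) (fun p hp => ?_) ?_
    · have : ¬ ∀ γ ∈ Γ, ∀ l < n, r / 2 ≤ ‖P p + l • a - γ‖ := by
        simpa [hG] using hp
      push Not at this
      obtain ⟨γ, hγ, l, hl, h⟩ := this
      exact ⟨(γ, l), by simp [hγ, hl], h⟩
    · rintro ⟨γ, l⟩ - p ⟨-, hp⟩ q ⟨-, hq⟩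
      by_contra hne
      have h1 := hsep p q hne
      have h2 : P p - P q = (P p + l • a - γ) - (P q + l • a - γ) := by abel
      have h3 := norm_sub_le (P p + l • a - γ) (P q + l • a - γ)
      rw [← h2] at h3
      simp only at hp hq
      linarith
  rw [Finset.card_product, Finset.card_range] at hbad
  have hadd := Finset.card_add_card_compl G
  rw [Fintype.card_prod, Fintype.card_fin, Fintype.card_fin] at hadd
  have : (Γ.card + 1) * n ≤ N * n := Nat.mul_le_mul_right _ hΓ
  rw [add_mul, one_mul] at this
  omega

/-- The increments of the Birkhoff sums of `h` around well separated discontinuities are, on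
average, the jumps of `h`. -/
theorem sum_abs_birkhoffSum_sub_le {N n : ℕ} {a : UnitAddCircle} {b : Fin N → UnitAddCircle}
    {d : Fin N → ℝ} {Γ : Finset UnitAddCircle} {h : UnitAddCircle → ℝ}
    {m : Measure UnitAddCircle} [IsFiniteMeasure m] {r s B : ℝ} (hs : 0 < s) (hsr : s < r / 2)
    (hsep : ∀ p q : Fin N × Fin n, p ≠ q →
      r ≤ ‖(b p.1 - (p.2 : ℕ) • a) - (b q.1 - (q.2 : ℕ) • a)‖)
    (hinc : ∀ x : UnitAddCircle, (∀ γ ∈ Γ, s < ‖x - γ‖) → (∀ i, x = b i ∨ s < ‖x - b i‖) →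
      |h (x + s) - h (x - s) - ∑ i, if x = b i then d i else 0| ≤ m.real (Metric.closedBall x s))
    (hm : ∀ E, MeasurableSet E → volume E ≤ ENNReal.ofReal (N * n * (2 * s)) → m.real E ≤ B)
    {G : Finset (Fin N × Fin n)}
    (hG : ∀ p ∈ G, ∀ γ ∈ Γ, ∀ l < n, r / 2 ≤ ‖b p.1 - (p.2 : ℕ) • a + l • a - γ‖) :
    ∑ p ∈ G, |∑ k ∈ Finset.range n, h (b p.1 - (p.2 : ℕ) • a + s + k • a) -
      ∑ k ∈ Finset.range n, h (b p.1 - (p.2 : ℕ) • a - s + k • a) - d p.1| ≤ n * B := by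
  classical
  have hr : 0 < r := by linarith
  set P : Fin N × Fin n → UnitAddCircle := fun p => b p.1 - (p.2 : ℕ) • a with hP
  have hPne : ∀ p q, P p = P q → p = q := by
    intro p q hpq
    by_contra hne
    have h1 := hsep p q hne
    change r ≤ ‖P p - P q‖ at h1
    rw [hpq, sub_self, norm_zero] at h1
    linarith
  have hterm : ∀ p ∈ G, |∑ k ∈ Finset.range n, h (P p + s + k • a) -
      ∑ k ∈ Finset.range n, h (P p - s + k • a) - d p.1| ≤
      ∑ k ∈ Finset.range n, m.real (Metric.closedBall (P p + k • a) s) := by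
    intro p hp
    have hxb : ∀ (l : Fin n) i, P p + (l : ℕ) • a - b i = P p - P (i, l) := by
      intro l i; simp only [hP]; abel
    -- The orbit of `P p` up to time `n` meets the points `b i` exactly once, at time `p.2`; any
    -- other meeting would make two of the separated points coincide.
    have hd : d p.1 = ∑ k ∈ Finset.range n, ∑ i, if P p + k • a = b i then d i else 0 := by
      rw [Finset.sum_range (fun k => ∑ i, if P p + k • a = b i then d i else 0),
        Finset.sum_comm, ← Fintype.sum_prod_type', Finset.sum_eq_single p]
      · rw [if_pos]
        rw [← sub_eq_zero, hxb, sub_self]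
      · rintro q - hq
        rw [if_neg]
        rw [← sub_eq_zero, hxb]
        exact fun h0 => hq (hPne _ _ (sub_eq_zero.1 h0)).symm
      · simp
    rw [hd, ← Finset.sum_sub_distrib, ← Finset.sum_sub_distrib]
    refine (Finset.abs_sum_le_sum_abs _ _).trans (Finset.sum_le_sum fun k hk => ?_)
    have hk' := Finset.mem_range.1 hk
    have h1 := hinc (P p + k • a) (fun γ hγ => hsr.trans_le (hG p hp γ hγ k hk')) (fun i => by
      by_cases hpi : p = (i, ⟨k, hk'⟩)
      · left
        rw [← sub_eq_zero, hxb ⟨k, hk'⟩ i, ← hpi, sub_self]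
      · right
        rw [hxb ⟨k, hk'⟩ i]
        have := hsep _ _ hpi
        change r ≤ ‖P p - P (i, ⟨k, hk'⟩)‖ at this
        linarith)
    rwa [add_right_comm, add_sub_right_comm] at h1
  refine (Finset.sum_le_sum hterm).trans ?_
  -- For fixed `k` the balls are disjoint, so their masses add up to the mass of a set of length at
  -- most `N * n * 2s`. Estimating each ball separately would lose a factor of order `n`.
  rw [Finset.sum_comm]
  calc ∑ k ∈ Finset.range n, ∑ p ∈ G, m.real (Metric.closedBall (P p + k • a) s)
      ≤ ∑ k ∈ Finset.range n, B := by
        refine Finset.sum_le_sum fun k _ => ?_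
        rw [← measureReal_biUnion_finset]
        · refine hm _ (Finset.measurableSet_biUnion _ fun _ _ => measurableSet_closedBall) ?_
          refine (measure_biUnion_finset_le _ _).trans ?_
          simp only [AddCircle.volume_closedBall]
          rw [Finset.sum_const, nsmul_eq_mul, mul_comm ((N : ℝ) * n), ENNReal.ofReal_mul (by positivity)]
          rw [mul_comm]
          gcongr
          · exact min_le_right _ _
          · rw [← Nat.cast_mul, ENNReal.ofReal_natCast]
            have := Finset.card_le_univ G
            rw [Fintype.card_prod, Fintype.card_fin, Fintype.card_fin] at this
            exact_mod_cast this
        · intro p _ q _ hpq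
          refine Metric.closedBall_disjoint_closedBall ?_
          have := hsep p q hpq
          change r ≤ ‖P p - P q‖ at this
          rw [dist_eq_norm, add_sub_add_right_eq_sub]
          linarith
        · exact fun _ _ => measurableSet_closedBall
    _ = n * B := by simp

/-- Integrating over disjoint balls. -/
theorem mul_volume_closedBall_le_lintegral {ι : Type*} {G : Finset ι} {P : ι → UnitAddCircle}
    {φ : UnitAddCircle → ENNReal} (hφ : Measurable φ) {σ r : ℝ} (hσ : σ < r / 2)
    (hsep : ∀ p q, p ≠ q → r ≤ ‖P p - P q‖) {K : ENNReal}
    (hK : ∀ᵐ z : UnitAddCircle, ‖z‖ ≤ σ → K ≤ ∑ p ∈ G, (φ (P p + z) + φ (P p - z))) :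
    K * volume (Metric.closedBall (0 : UnitAddCircle) σ) ≤ 2 * ∫⁻ x, φ x := by
  set S := Metric.closedBall (0 : UnitAddCircle) σ with hS
  have hSm : MeasurableSet S := measurableSet_closedBall
  have hadd : ∀ p, ∫⁻ z in S, φ (P p + z) = ∫⁻ x in Metric.closedBall (P p) σ, φ x := by
    intro p
    have hpre : (fun z => P p + z) ⁻¹' Metric.closedBall (P p) σ = S := by
      ext z; simp [hS, dist_eq_norm]
    rw [← hpre]
    exact (measurePreserving_add_left volume (P p)).setLIntegral_comp_preimage
      measurableSet_closedBall hφ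
  have hsub : ∀ p, ∫⁻ z in S, φ (P p - z) = ∫⁻ x in Metric.closedBall (P p) σ, φ x := by
    intro p
    have hpre : (fun z => P p - z) ⁻¹' Metric.closedBall (P p) σ = S := by
      ext z; simp [hS, dist_eq_norm]
    rw [← hpre]
    exact (Measure.measurePreserving_sub_left volume (P p)).setLIntegral_comp_preimage
      measurableSet_closedBall hφ
  have hdisj : ∑ p ∈ G, ∫⁻ x in Metric.closedBall (P p) σ, φ x ≤ ∫⁻ x, φ x := by
    rw [← lintegral_biUnion_finset (fun p _ q _ hpq => ?_) (fun _ _ => measurableSet_closedBall)]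
    · exact setLIntegral_le_lintegral _ _
    · refine Metric.closedBall_disjoint_closedBall ?_
      have := hsep p q hpq
      rw [dist_eq_norm]; linarith
  have hma : ∀ p, Measurable fun z => φ (P p + z) := fun p => hφ.comp (measurable_const_add _)
  have hms : ∀ p, Measurable fun z => φ (P p - z) := fun p => hφ.comp (measurable_const_sub _)
  calc K * volume S = ∫⁻ _ in S, K := by rw [setLIntegral_const]
    _ ≤ ∫⁻ z in S, ∑ p ∈ G, (φ (P p + z) + φ (P p - z)) := by
        refine setLIntegral_mono_ae' hSm ?_
        filter_upwards [hK] with z hz hzS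
        exact hz (by simpa [hS] using hzS)
    _ = (∑ p ∈ G, ∫⁻ z in S, φ (P p + z)) + ∑ p ∈ G, ∫⁻ z in S, φ (P p - z) := by
        rw [lintegral_finsetSum (f := fun p z => φ (P p + z) + φ (P p - z)) _
          (fun p _ => (hma p).add (hms p)), ← Finset.sum_add_distrib]
        exact Finset.sum_congr rfl fun p _ => lintegral_add_left (hma p) _
    _ ≤ 2 * ∫⁻ x, φ x := by
        simp only [hadd, hsub]
        rw [two_mul]
        gcongr

theorem UnitAddCircle.exists_coe_eq_abs_eq_norm (z : UnitAddCircle) :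
    ∃ y : ℝ, (y : UnitAddCircle) = z ∧ |y| = ‖z‖ := by
  induction z using QuotientAddGroup.induction_on with
  | H y =>
    refine ⟨y - round y, ?_, (UnitAddCircle.norm_eq).symm⟩
    rw [AddCircle.coe_sub, sub_eq_self, AddCircle.coe_eq_zero_iff]
    exact ⟨round y, by simp⟩

theorem norm_exp_sub_exp (x y : ℝ) :
    ‖Complex.exp (Complex.I * x) - Complex.exp (Complex.I * y)‖ =
      ‖Complex.exp (Complex.I * (x - y : ℝ)) - 1‖ := by
  have h1 : ‖Complex.exp (Complex.I * y)‖ = 1 := by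
    rw [mul_comm]; exact Complex.norm_exp_ofReal_mul_I y
  have h : Complex.exp (Complex.I * x) - Complex.exp (Complex.I * y) =
      (Complex.exp (Complex.I * (x - y : ℝ)) - 1) * Complex.exp (Complex.I * y) := by
    rw [sub_mul, ← Complex.exp_add, one_mul]; congr 2; push_cast; ring
  rw [h, norm_mul, h1, mul_one]

/-- Each point of `G` contributes `tδ/2` minus `t` times its error. The errors total at most `n ·
3δ/8`, which leaves `n · tδ/8`. -/
theorem le_sum_norm_exp_birkhoffSum_sub_one {N n : ℕ} {a : UnitAddCircle}
    {b : Fin N → UnitAddCircle}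
    {d : Fin N → ℝ} {Γ : Finset UnitAddCircle} {h : UnitAddCircle → ℝ}
    {m : Measure UnitAddCircle} [IsFiniteMeasure m] {r s δ t : ℝ} (hd : ∀ i, δ ≤ d i)
    (hδ : 0 ≤ δ) (ht : 0 ≤ t) (htd : ∀ i, t * d i ≤ Real.pi) (hs : 0 < s) (hsr : s < r / 2)
    (hsep : ∀ p q : Fin N × Fin n, p ≠ q →
      r ≤ ‖(b p.1 - (p.2 : ℕ) • a) - (b q.1 - (q.2 : ℕ) • a)‖)
    (hinc : ∀ x : UnitAddCircle, (∀ γ ∈ Γ, s < ‖x - γ‖) → (∀ i, x = b i ∨ s < ‖x - b i‖) →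
      |h (x + s) - h (x - s) - ∑ i, if x = b i then d i else 0| ≤ m.real (Metric.closedBall x s))
    (hm : ∀ E, MeasurableSet E → volume E ≤ ENNReal.ofReal (N * n * (2 * s)) →
      m.real E ≤ 3 * δ / 8)
    {G : Finset (Fin N × Fin n)}
    (hG : ∀ p ∈ G, ∀ γ ∈ Γ, ∀ l < n, r / 2 ≤ ‖b p.1 - (p.2 : ℕ) • a + l • a - γ‖)
    (hGcard : n ≤ G.card) :
    n * (t * δ / 8) ≤ ∑ p ∈ G,
      (‖Complex.exp (Complex.I * ((t * ∑ k ∈ Finset.range n,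
          h (b p.1 - (p.2 : ℕ) • a + s + k • a) : ℝ) : ℂ)) - 1‖ +
        ‖Complex.exp (Complex.I * ((t * ∑ k ∈ Finset.range n,
          h (b p.1 - (p.2 : ℕ) • a - s + k • a) : ℝ) : ℂ)) - 1‖) := by
  have h1 := sum_abs_birkhoffSum_sub_le hs hsr hsep hinc hm hG
  generalize hX : (fun p : Fin N × Fin n =>
    ∑ k ∈ Finset.range n, h (b p.1 - (p.2 : ℕ) • a + s + k • a)) = X at h1 ⊢
  generalize hY : (fun p : Fin N × Fin n =>
    ∑ k ∈ Finset.range n, h (b p.1 - (p.2 : ℕ) • a - s + k • a)) = Y at h1 ⊢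
  simp only [congrFun hX, congrFun hY] at h1 ⊢
  have h2 : ∀ p ∈ G, t * δ / 2 - t * |X p - Y p - d p.1| ≤
      ‖Complex.exp (Complex.I * ((t * X p : ℝ) : ℂ)) - 1‖ +
        ‖Complex.exp (Complex.I * ((t * Y p : ℝ) : ℂ)) - 1‖ := by
    intro p _
    have h3 := le_norm_exp_sub_one_add (t * X p) (t * Y p) (t * d p.1)
      (mul_nonneg ht (hδ.trans (hd _))) (htd _)
    rw [← mul_sub, ← mul_sub, abs_mul, abs_of_nonneg ht] at h3
    have := mul_le_mul_of_nonneg_left (hd p.1) ht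
    linarith
  refine le_trans ?_ (Finset.sum_le_sum h2)
  rw [Finset.sum_sub_distrib, Finset.sum_const, nsmul_eq_mul, ← Finset.mul_sum]
  have h4 : (n : ℝ) ≤ G.card := by exact_mod_cast hGcard
  have h5 := mul_le_mul_of_nonneg_right h4 (by positivity : 0 ≤ t * δ / 2)
  have h6 := mul_le_mul_of_nonneg_left h1 ht
  linarith

/-- A function whose increments are dominated by finitely many jumps at rational points, apart from
fewer exceptional points, is not a coboundary over a badly approximable rotation. -/
theorem not_isCoboundary_of_increments {α c : ℝ} (hc : 0 < c)
    (hα : ∀ k : ℕ, 0 < k → c / k ≤ ‖((k * α : ℝ) : UnitAddCircle)‖)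
    {N : ℕ} (b : Fin N → ℚ) (hb : ∀ i j, i ≠ j → ∀ z : ℤ, b i - b j ≠ z)
    {d : Fin N → ℝ} {δ : ℝ} (hδ : 0 < δ) (hd : ∀ i, δ ≤ d i)
    {Γ : Finset UnitAddCircle} (hΓ : Γ.card < N) {h : UnitAddCircle → ℝ}
    {m : Measure UnitAddCircle} [IsFiniteMeasure m]
    (hinc : ∀ (x : UnitAddCircle) (s : ℝ), 0 < s → (∀ γ ∈ Γ, s < ‖x - γ‖) →
      (∀ i, x = ((b i : ℝ) : UnitAddCircle) ∨ s < ‖x - ((b i : ℝ) : UnitAddCircle)‖) →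
      |h (x + s) - h (x - s) - ∑ i, if x = ((b i : ℝ) : UnitAddCircle) then d i else 0| ≤
        m.real (Metric.closedBall x s))
    {ω : ℝ} (hω : 0 < ω)
    (hm : ∀ E, MeasurableSet E → volume E ≤ ENNReal.ofReal ω → m.real E ≤ 3 * δ / 8) :
    ¬ IsCoboundary α h := by
  classical
  intro hcob
  obtain ⟨j, hj, hjn⟩ := hcob.exists_birkhoffSum
  obtain ⟨ρ, hρ, hsep⟩ := exists_separation hc hα b hb
  set a : UnitAddCircle := (α : UnitAddCircle) with ha
  have hN : 0 < N := lt_of_le_of_lt (Nat.zero_le _) hΓ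
  have hN' : (0 : ℝ) < N := by exact_mod_cast hN
  set D : ℝ := ∑ i, d i with hD
  have hd0 : ∀ i, 0 ≤ d i := fun i => hδ.le.trans (hd i)
  have hdD : ∀ i, d i ≤ D := fun i => Finset.single_le_sum (fun i _ => hd0 i) (Finset.mem_univ i)
  have hDpos : 0 < D := hδ.trans_le ((hd ⟨0, hN⟩).trans (hdD _))
  -- This frequency keeps every `t * d i` in `[0, π]`, so that no jump is lost modulo `2π`.
  set t : ℝ := Real.pi / D with ht
  have htpos : 0 < t := div_pos Real.pi_pos hDpos
  have htd : ∀ i, t * d i ≤ Real.pi := by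
    intro i
    rw [ht, div_mul_eq_mul_div, div_le_iff₀ hDpos]
    exact mul_le_mul_of_nonneg_left (hdD i) Real.pi_pos.le
  -- With `σ = ρ' / n`: the first bound makes the `σ`-balls disjoint, the second gives them volume
  -- `2σ`, the third keeps their total length `N * n * 2σ` below `ω`.
  set ρ' : ℝ := min (min (ρ / 4) (1 / 2)) (ω / (2 * N)) with hρ'
  have hρ'pos : 0 < ρ' := by positivity
  have hρ'1 : ρ' ≤ ρ / 4 := (min_le_left _ _).trans (min_le_left _ _)
  have hρ'2 : ρ' ≤ 1 / 2 := (min_le_left _ _).trans (min_le_right _ _)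
  have hρ'3 : ρ' * (2 * N) ≤ ω := by
    rw [← le_div_iff₀ (by positivity)]; exact min_le_right _ _
  set u : UnitAddCircle → ℂ := fun x => Complex.exp (Complex.I * ((t * j x : ℝ) : ℂ)) with hu
  have hum : Measurable u := by fun_prop
  have hui : Integrable u := by
    refine Integrable.of_bound hum.aestronglyMeasurable 1 (Filter.Eventually.of_forall fun x => ?_)
    simp only [hu]
    rw [mul_comm]; exact (Complex.norm_exp_ofReal_mul_I _).le
  -- The threshold is exactly the lower bound obtained below; being independent of `n`, it can be
  -- fixed before `n`.
  obtain ⟨η, hη, hlt⟩ := exists_lintegral_enorm_sub_translate_lt hui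
    (ε := t * δ * ρ' / 8) (by positivity)
  obtain ⟨M, hM⟩ := exists_nat_one_div_lt hη
  obtain ⟨n, hn, hnorm⟩ := AddCircle.exists_norm_nsmul_le (T := 1) a (n := M + 1) M.succ_pos
  have hnη : ‖n • a‖ < η := by
    refine hnorm.trans_lt (lt_of_le_of_lt ?_ hM)
    push_cast
    gcongr
    linarith
  have hnpos : 0 < n := hn.1
  have hn' : (0 : ℝ) < n := by exact_mod_cast hnpos
  have hsmall := hlt _ hnη
  set φ : UnitAddCircle → ENNReal := fun x => ‖u x - u (x + n • a)‖ₑ with hφ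
  have hφm : Measurable φ := (hum.sub (hum.comp (measurable_add_const _))).enorm
  set P : Fin N × Fin n → UnitAddCircle :=
    fun p => ((b p.1 : ℝ) : UnitAddCircle) - (p.2 : ℕ) • a with hP
  set σ : ℝ := ρ' / n with hσ
  have hσr : σ < ρ / n / 2 := by
    rw [hσ, div_div, div_lt_div_iff₀ hn' (by positivity)]
    nlinarith
  obtain ⟨G, hGcard, hG⟩ := exists_finset_away (a := a) (P := P) hΓ (hsep n)
  set H : UnitAddCircle → ℝ := fun x => ∑ k ∈ Finset.range n, h (x + k • a) with hH
  set Φ : UnitAddCircle → ℝ := fun x => ‖Complex.exp (Complex.I * ((t * H x : ℝ) : ℂ)) - 1‖ with hΦ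
  have hdet : ∀ s : ℝ, 0 < s → s ≤ σ →
      n * (t * δ / 8) ≤ ∑ p ∈ G, (Φ (P p + s) + Φ (P p - s)) := by
    intro s hs hsσ
    refine le_sum_norm_exp_birkhoffSum_sub_one (a := a) (r := ρ / n)
      (b := fun i => ((b i : ℝ) : UnitAddCircle)) hd hδ.le htpos.le htd hs (hsσ.trans_lt hσr) (hsep n)
      (fun x => hinc x s hs) (fun E hE hEv => hm E hE (hEv.trans ?_)) hG hGcard
    refine ENNReal.ofReal_le_ofReal ?_
    calc (N : ℝ) * n * (2 * s) ≤ N * n * (2 * σ) := by gcongr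
      _ = ρ' * (2 * N) := by rw [hσ]; field_simp
      _ ≤ ω := hρ'3
  have hae : ∀ᵐ z : UnitAddCircle, ∀ p, φ (P p + z) = ENNReal.ofReal (Φ (P p + z)) ∧
      φ (P p - z) = ENNReal.ofReal (Φ (P p - z)) := by
    have hbase : ∀ᵐ x : UnitAddCircle, φ x = ENNReal.ofReal (Φ x) := by
      filter_upwards [hjn n] with x hx
      simp only [hφ, hΦ, hu, hH]
      rw [← ofReal_norm, norm_exp_sub_exp, hx, mul_sub]
    refine ae_all_iff.2 fun p => ?_
    filter_upwards [(measurePreserving_add_left volume (P p)).quasiMeasurePreserving.ae hbase,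
      (Measure.measurePreserving_sub_left volume (P p)).quasiMeasurePreserving.ae hbase]
      with z h1 h2 using ⟨h1, h2⟩
  have hne : ∀ᵐ z : UnitAddCircle, z ≠ 0 := by
    have : volume ({0} : Set UnitAddCircle) = 0 := by
      have := AddCircle.volume_closedBall (T := 1) (x := 0) 0
      simpa using this
    exact compl_mem_ae_iff.2 this
  have hmain := mul_volume_closedBall_le_lintegral (G := G) (P := P) hφm hσr (hsep n)
    (K := ENNReal.ofReal (n * (t * δ / 8))) (by
      filter_upwards [hae, hne] with z hz hz0 hzσ
      have hz' : ∑ p ∈ G, (φ (P p + z) + φ (P p - z)) =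
          ENNReal.ofReal (∑ p ∈ G, (Φ (P p + z) + Φ (P p - z))) := by
        rw [ENNReal.ofReal_sum_of_nonneg fun p _ => by positivity]
        refine Finset.sum_congr rfl fun p _ => ?_
        rw [(hz p).1, (hz p).2, ENNReal.ofReal_add (norm_nonneg _) (norm_nonneg _)]
      rw [hz']
      refine ENNReal.ofReal_le_ofReal ?_
      -- The sum is invariant under `z ↦ -z`, so a negative `y` reduces to `-y`.
      obtain ⟨y, rfl, hy⟩ := UnitAddCircle.exists_coe_eq_abs_eq_norm z
      have hy0 : y ≠ 0 := by rintro rfl; exact hz0 rfl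
      rcases lt_or_gt_of_ne hy0 with hlt | hgt
      · have := hdet (-y) (by linarith) (by rw [← abs_of_neg hlt, hy]; exact hzσ)
        refine this.trans (le_of_eq (Finset.sum_congr rfl fun p _ => ?_))
        rw [AddCircle.coe_neg, sub_neg_eq_add, ← sub_eq_add_neg, add_comm]
      · exact hdet y hgt (by rw [← abs_of_pos hgt, hy]; exact hzσ))
  have hmin : min 1 (2 * σ) = 2 * σ := by
    refine min_eq_right ?_
    have hn1 : (1 : ℝ) ≤ n := by exact_mod_cast hnpos
    have : σ ≤ ρ' := div_le_self hρ'pos.le hn1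
    linarith
  rw [AddCircle.volume_closedBall, hmin, ← ENNReal.ofReal_mul (by positivity)] at hmain
  have hval : (n : ℝ) * (t * δ / 8) * (2 * σ) = 2 * (t * δ * ρ' / 8) := by
    rw [hσ]; field_simp
  rw [hval, ENNReal.ofReal_mul two_pos.le, ENNReal.ofReal_ofNat] at hmain
  have h2 := (ENNReal.mul_le_mul_iff_right (by norm_num) (by norm_num)).1 hmain
  exact absurd hsmall (not_lt.2 h2)

/-! ### Jumps of functions on the circle and their summability. -/

theorem circleLift_add_intCast (f : UnitAddCircle → ℝ) (x : ℝ) (z : ℤ) :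
    circleLift f (x + z) = circleLift f x := by
  simp only [circleLift]
  congr 1
  rw [AddCircle.coe_add, add_eq_left, AddCircle.coe_eq_zero_iff]
  exact ⟨z, by simp⟩

theorem rightLim_circleLift_add_intCast (f : UnitAddCircle → ℝ) (y : ℝ) (z : ℤ) :
    Function.rightLim (circleLift f) (y + z) = Function.rightLim (circleLift f) y := by
  have hmap : map (circleLift f) (𝓝[>] (y + z)) = map (circleLift f) (𝓝[>] y) := by
    have h1 : map (fun x : ℝ => x + z) (𝓝[>] y) = 𝓝[>] (y + z) := by simp
    rw [← h1, map_map]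
    congr 1
    funext x
    exact circleLift_add_intCast f x z
  by_cases h : ∃ l, Tendsto (circleLift f) (𝓝[>] y) (𝓝 l)
  · obtain ⟨l, hl⟩ := h
    rw [rightLim_eq_of_tendsto hl, rightLim_eq_of_tendsto (y := l)]
    rw [Tendsto, hmap]; exact hl
  -- Without a limit, `rightLim` takes the value of the function itself, which is also periodic.
  · rw [rightLim_eq_of_not_tendsto _ h, rightLim_eq_of_not_tendsto, circleLift_add_intCast]
    simpa only [Tendsto, hmap] using h

theorem leftLim_circleLift_add_intCast (f : UnitAddCircle → ℝ) (y : ℝ) (z : ℤ) :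
    Function.leftLim (circleLift f) (y + z) = Function.leftLim (circleLift f) y := by
  have hmap : map (circleLift f) (𝓝[<] (y + z)) = map (circleLift f) (𝓝[<] y) := by
    have h1 : map (fun x : ℝ => x + z) (𝓝[<] y) = 𝓝[<] (y + z) := by simp
    rw [← h1, map_map]
    congr 1
    funext x
    exact circleLift_add_intCast f x z
  by_cases h : ∃ l, Tendsto (circleLift f) (𝓝[<] y) (𝓝 l)
  · obtain ⟨l, hl⟩ := h
    rw [leftLim_eq_of_tendsto hl, leftLim_eq_of_tendsto (y := l)]
    rw [Tendsto, hmap]; exact hl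
  · rw [leftLim_eq_of_not_tendsto _ h, leftLim_eq_of_not_tendsto, circleLift_add_intCast]
    simpa only [Tendsto, hmap] using h

theorem circleJump_fract (f : UnitAddCircle → ℝ) (y : ℝ) :
    circleJump f (Int.fract y) = circleJump f y := by
  conv_rhs => rw [← Int.fract_add_floor y]
  rw [circleJump, circleJump, rightLim_circleLift_add_intCast, leftLim_circleLift_add_intCast]

theorem circleJump_eq_zero_of_continuousAt {f : UnitAddCircle → ℝ} {y : ℝ}
    (h : ContinuousAt (circleLift f) y) : circleJump f y = 0 := by
  rw [circleJump, h.continuousWithinAt.rightLim_eq, h.continuousWithinAt.leftLim_eq, sub_self]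

theorem circleJump_eq_zero_of_continuousAt_coe {f : UnitAddCircle → ℝ} {y : ℝ}
    (h : ContinuousAt f (y : UnitAddCircle)) : circleJump f y = 0 :=
  circleJump_eq_zero_of_continuousAt
    (ContinuousAt.comp (g := f) h (AddCircle.continuous_mk' 1).continuousAt)

theorem jumpPart_eq_tsum_indicator (f : UnitAddCircle → ℝ) (x : ℝ) :
    jumpPart f x = ∑' y : ℝ, (Ico 0 x).indicator (circleJump f) y :=
  tsum_subtype (Ico 0 x) (circleJump f)

/-- Nonnegative jumps of a function without singular part are summable. -/
theorem IsBVaj.summable_circleJump {f : UnitAddCircle → ℝ} (hf : IsBVaj f)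
    (hJ : ∀ y, 0 ≤ circleJump f y) : Summable ((Ico 0 1).indicator (circleJump f)) := by
  classical
  set J := circleJump f
  obtain ⟨C, hC⟩ := hf.noSingularPart.exists_bound
  obtain ⟨K, hK⟩ : ∃ K, ∀ x ∈ Icc (0 : ℝ) 1, |circleLift f x| ≤ K := by
    refine ⟨(eVariationOn (circleLift f) (Icc 0 1)).toReal + |circleLift f 0|, fun x hx => ?_⟩
    have h1 := hf.boundedVariation.dist_le hx (left_mem_Icc.2 zero_le_one)
    rw [Real.dist_eq] at h1
    have := abs_sub_abs_le_abs_sub (circleLift f x) (circleLift f 0)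
    linarith
  have hbound : ∀ x ∈ Icc (0 : ℝ) 1, jumpPart f x ≤ K + C := by
    intro x hx
    have h1 := hC x (by rwa [uIcc_of_le zero_le_one])
    have h2 := hK x hx
    rw [Real.norm_eq_abs] at h1
    have h3 := abs_le.1 h1
    have h4 := abs_le.1 h2
    linarith [h3.1, h4.2]
  have hnn : ∀ x y, 0 ≤ (Ico 0 x).indicator J y := fun x y => indicator_nonneg (fun y _ => hJ y) y
  -- `jumpPart` is `0` by default where the jumps are not summable, so summability must be proved.
  -- It holds up to `sSup S`, where `jumpPart` is bounded; beyond, the default value makes `f`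
  -- continuous, so no jumps remain.
  set S : Set ℝ := {x | x ∈ Icc (0 : ℝ) 1 ∧ Summable ((Ico 0 x).indicator J)} with hS
  have h0 : (0 : ℝ) ∈ S := ⟨by simp, by simp⟩
  have hbdd : BddAbove S := ⟨1, fun x hx => hx.1.2⟩
  have hsup0 : 0 ≤ sSup S := le_csSup hbdd h0
  have hsum : Summable ((Ico 0 (sSup S)).indicator J) := by
    refine summable_of_sum_le (c := K + C) (hnn _) fun u => ?_
    obtain ⟨z, hz, huz⟩ : ∃ z ∈ S, ∀ y ∈ u, y < sSup S → y < z := by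
      rcases (u.filter (· < sSup S)).eq_empty_or_nonempty with he | hne
      · exact ⟨0, h0, fun y hy hlt => absurd hlt (Finset.filter_eq_empty_iff.1 he hy)⟩
      · obtain ⟨z, hz, hlt⟩ := exists_lt_of_lt_csSup ⟨0, h0⟩
          (Finset.mem_filter.1 (Finset.max'_mem _ hne)).2
        exact ⟨z, hz, fun y hy hy' =>
          (Finset.le_max' _ y (Finset.mem_filter.2 ⟨hy, hy'⟩)).trans_lt hlt⟩
    calc ∑ y ∈ u, (Ico 0 (sSup S)).indicator J y ≤ ∑ y ∈ u, (Ico 0 z).indicator J y := by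
          refine Finset.sum_le_sum fun y hy => ?_
          by_cases hy' : y ∈ Ico 0 (sSup S)
          · rw [indicator_of_mem hy', indicator_of_mem (show y ∈ Ico 0 z from
              ⟨hy'.1, huz y hy hy'.2⟩)]
          · rw [indicator_of_notMem hy']; exact hnn _ _
      _ ≤ ∑' y, (Ico 0 z).indicator J y := hz.2.sum_le_tsum _ fun y _ => hnn _ _
      _ = jumpPart f z := (jumpPart_eq_tsum_indicator f z).symm
      _ ≤ K + C := hbound z hz.1
  have hzero : ∀ y ∈ Ioo (sSup S) 1, J y = 0 := by
    intro y hy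
    have hA := hf.noSingularPart.continuousOn
    rw [uIcc_of_le zero_le_one] at hA
    have hAy : ContinuousAt (fun x => circleLift f x - jumpPart f x) y :=
      hA.continuousAt (Icc_mem_nhds (hsup0.trans_lt hy.1) hy.2)
    refine circleJump_eq_zero_of_continuousAt (hAy.congr ?_)
    filter_upwards [Ioo_mem_nhds hy.1 hy.2] with x hx
    rw [jumpPart_eq_tsum_indicator, tsum_eq_zero_of_not_summable, sub_zero]
    intro hs
    exact absurd (le_csSup hbdd (show x ∈ S from ⟨⟨hsup0.trans hx.1.le, hx.2.le⟩, hs⟩))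
      (not_le.2 hx.1)
  refine Summable.of_nonneg_of_le (hnn 1) (fun y => ?_)
    (hsum.add (hasSum_ite_eq (sSup S) (J (sSup S))).summable)
  by_cases hy : y ∈ Ico (0 : ℝ) 1
  · rw [indicator_of_mem hy]
    rcases lt_trichotomy y (sSup S) with h | h | h
    · rw [indicator_of_mem (show y ∈ Ico 0 (sSup S) from ⟨hy.1, h⟩), if_neg h.ne, add_zero]
    · rw [h]; simp
    · rw [hzero y ⟨h, hy.2⟩]
      refine add_nonneg (hnn _ _) ?_
      split_ifs
      exacts [hJ _, le_rfl]
  · rw [indicator_of_notMem hy]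
    refine add_nonneg (hnn _ _) ?_
    split_ifs
    exacts [hJ _, le_rfl]

theorem coe_fract_eq (x : ℝ) : ((Int.fract x : ℝ) : UnitAddCircle) = x := by
  rw [eq_comm, ← sub_eq_zero, ← AddCircle.coe_sub, Int.self_sub_fract, AddCircle.coe_eq_zero_iff]
  exact ⟨⌊x⌋, by simp⟩

section Enumerated

variable {f : UnitAddCircle → ℝ} {β : ℕ → ℚ}

theorem fract_injective_of_sub_ne_int (hβ : ∀ i j, i ≠ j → ∀ z : ℤ, β i - β j ≠ z) :
    Function.Injective fun i => Int.fract (β i : ℝ) := by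
  intro i j hij
  by_contra hne
  obtain ⟨z, hz⟩ := Int.fract_eq_fract.1 hij
  exact hβ i j hne z (by exact_mod_cast hz)

theorem support_indicator_circleJump_subset
    (hdisc : {x : UnitAddCircle | ¬ ContinuousAt f x} =
      range (fun i : ℕ => (((β i : ℚ) : ℝ) : UnitAddCircle))) {x : ℝ} (hx : x ≤ 1) :
    Function.support ((Ico 0 x).indicator (circleJump f)) ⊆
      range fun i => Int.fract (β i : ℝ) := by
  intro y hy
  have hyI : y ∈ Ico 0 x := by
    by_contra h; exact hy (indicator_of_notMem h _)
  rw [Function.mem_support, indicator_of_mem hyI] at hy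
  have h1 : (y : UnitAddCircle) ∈ {x : UnitAddCircle | ¬ ContinuousAt f x} :=
    fun h => hy (circleJump_eq_zero_of_continuousAt_coe h)
  rw [hdisc] at h1
  obtain ⟨i, hi⟩ := h1
  refine ⟨i, ?_⟩
  rw [← (AddCircle.coe_eq_coe_iff_of_mem_Ico (p := (1 : ℝ)) (a := 0)
    ⟨Int.fract_nonneg _, by simpa using Int.fract_lt_one _⟩
    ⟨hyI.1, by simpa using hyI.2.trans_le hx⟩), ← hi]
  exact coe_fract_eq _

theorem circleJump_nonneg
    (hdisc : {x : UnitAddCircle | ¬ ContinuousAt f x} =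
      range (fun i : ℕ => (((β i : ℚ) : ℝ) : UnitAddCircle)))
    (hpos : ∀ i, 0 < circleJump f (β i)) (y : ℝ) : 0 ≤ circleJump f y := by
  rw [← circleJump_fract]
  by_contra h
  have hmem : Int.fract y ∈ Ico (0 : ℝ) 1 := ⟨Int.fract_nonneg y, Int.fract_lt_one y⟩
  obtain ⟨i, hi⟩ := support_indicator_circleJump_subset hdisc le_rfl
    (show Int.fract y ∈ Function.support ((Ico 0 1).indicator (circleJump f)) by
      rw [Function.mem_support, indicator_of_mem hmem]
      exact fun h0 => h h0.ge)
  apply h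
  rw [← hi]
  simp only [circleJump_fract]
  exact (hpos i).le

theorem IsBVaj.summable_circleJump_comp (hf : IsBVaj f)
    (hdisc : {x : UnitAddCircle | ¬ ContinuousAt f x} =
      range (fun i : ℕ => (((β i : ℚ) : ℝ) : UnitAddCircle)))
    (hβ : ∀ i j, i ≠ j → ∀ z : ℤ, β i - β j ≠ z)
    (hpos : ∀ i, 0 < circleJump f (β i)) : Summable fun i => circleJump f (β i) := by
  have h1 := (hf.summable_circleJump (circleJump_nonneg hdisc hpos)).comp_injective
    (fract_injective_of_sub_ne_int hβ)
  refine h1.congr fun i => ?_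
  simp only [Function.comp]
  rw [indicator_of_mem (show Int.fract (β i : ℝ) ∈ Ico (0 : ℝ) 1 from
    ⟨Int.fract_nonneg _, Int.fract_lt_one _⟩), circleJump_fract]

theorem jumpPart_eq_tsum
    (hdisc : {x : UnitAddCircle | ¬ ContinuousAt f x} =
      range (fun i : ℕ => (((β i : ℚ) : ℝ) : UnitAddCircle)))
    (hβ : ∀ i j, i ≠ j → ∀ z : ℤ, β i - β j ≠ z) {x : ℝ} (hx : x ≤ 1) :
    jumpPart f x = ∑' i, if Int.fract (β i : ℝ) < x then circleJump f (β i) else 0 := by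
  rw [jumpPart_eq_tsum_indicator, ← (fract_injective_of_sub_ne_int hβ).tsum_eq
    (support_indicator_circleJump_subset hdisc hx)]
  refine tsum_congr fun i => ?_
  rw [indicator_apply, circleJump_fract]
  simp [Int.fract_nonneg]

end Enumerated

/-! ### Measures controlling increments. -/

/-- The total variation measure of an absolutely continuous function. -/
theorem AbsolutelyContinuousOnInterval.exists_measure {A : ℝ → ℝ} {p q : ℝ} (hpq : p ≤ q)
    (hA : AbsolutelyContinuousOnInterval A p q) :
    ∃ ν : Measure ℝ, IsFiniteMeasure ν ∧ ν ≪ volume.restrict (Ioc p q) ∧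
      ∀ x y, p ≤ x → x ≤ y → y ≤ q → |A y - A x| ≤ ν.real (Icc x y) := by
  have hint : IntegrableOn (deriv A) (Ioc p q) := by
    have := hA.intervalIntegrable_deriv
    rwa [intervalIntegrable_iff_integrableOn_Ioc_of_le hpq] at this
  refine ⟨(volume.restrict (Ioc p q)).withDensity fun x => ‖deriv A x‖ₑ,
    isFiniteMeasure_withDensity hint.2.ne, withDensity_absolutelyContinuous _ _,
    fun x y hpx hxy hyq => ?_⟩
  have hsub : uIcc x y ⊆ uIcc p q := by
    rw [uIcc_of_le hxy, uIcc_of_le hpq]; exact Icc_subset_Icc hpx hyq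
  have hxyI : Ioc x y ⊆ Ioc p q := Ioc_subset_Ioc hpx hyq
  rw [← (hA.mono hsub).integral_deriv_eq_sub, ← Real.norm_eq_abs]
  refine (intervalIntegral.norm_integral_le_integral_norm hxy).trans ?_
  rw [intervalIntegral.integral_of_le hxy, integral_norm_eq_lintegral_enorm
    (hint.mono_set hxyI).aestronglyMeasurable, Measure.real]
  refine ENNReal.toReal_mono (measure_ne_top_of_subset (subset_univ _) ?_) ?_
  · rw [withDensity_apply _ MeasurableSet.univ, Measure.restrict_univ]; exact hint.2.ne
  · rw [withDensity_apply _ measurableSet_Icc, Measure.restrict_restrict measurableSet_Icc]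
    exact lintegral_mono_set (subset_inter Ioc_subset_Icc_self hxyI)

/-- The Radon–Nikodym density is integrable, so its integral is uniformly small over sets of small
measure. -/
theorem Measure.AbsolutelyContinuous.exists_pos_measureReal_le {X : Type*} [MeasurableSpace X]
    {μ ν : Measure X} [IsFiniteMeasure ν] [SigmaFinite μ] (h : ν ≪ μ) {η : ℝ} (hη : 0 < η) :
    ∃ ω : ℝ, 0 < ω ∧ ∀ E, MeasurableSet E → μ E ≤ ENNReal.ofReal ω → ν.real E ≤ η := by
  obtain ⟨δ, hδ, hlt⟩ := exists_pos_setLIntegral_lt_of_measure_lt (f := ν.rnDeriv μ) (μ := μ)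
    (Measure.lintegral_rnDeriv_lt_top ν μ).ne (ε := ENNReal.ofReal η) (by simpa using hη)
  obtain ⟨ω, hω, hωδ⟩ : ∃ ω : ℝ, 0 < ω ∧ ENNReal.ofReal ω < δ := by
    obtain ⟨w, hw0, hw⟩ := ENNReal.lt_iff_exists_nnreal_btwn.1 hδ
    exact ⟨w, by exact_mod_cast hw0, by simpa using hw⟩
  refine ⟨ω, hω, fun E hE hE' => ENNReal.toReal_le_of_le_ofReal hη.le ?_⟩
  have := hlt E (hE'.trans_lt hωδ)
  rw [Measure.setLIntegral_rnDeriv h] at this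
  exact this.le

theorem map_coe_absolutelyContinuous {ν : Measure ℝ} (h : ν ≪ volume.restrict (Ioc 0 1)) :
    ν.map ((↑) : ℝ → UnitAddCircle) ≪ volume := by
  have hmp := UnitAddCircle.measurePreserving_mk 0
  rw [zero_add] at hmp
  have := h.map hmp.measurable
  rwa [hmp.map_eq] at this

theorem UnitAddCircle.norm_coe_le_abs (x : ℝ) : ‖(x : UnitAddCircle)‖ ≤ |x| := by
  rw [UnitAddCircle.norm_eq]
  simpa using round_le x 0

theorem measureReal_Icc_le_map_coe {ν : Measure ℝ} [IsFiniteMeasure ν] (c s : ℝ) :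
    ν.real (Icc (c - s) (c + s)) ≤
      (ν.map ((↑) : ℝ → UnitAddCircle)).real (Metric.closedBall (c : UnitAddCircle) s) := by
  rw [map_measureReal_apply AddCircle.measurable_mk' measurableSet_closedBall]
  refine measureReal_mono fun y hy => ?_
  rw [mem_preimage, Metric.mem_closedBall, dist_eq_norm]
  refine le_trans ?_ (abs_sub_le_iff.2 ⟨by linarith [hy.2], by linarith [hy.1]⟩ : |y - c| ≤ s)
  rw [← AddCircle.coe_sub]
  exact UnitAddCircle.norm_coe_le_abs _

theorem exists_mem_Ico_of_partition {a : ℕ → ℝ} {N : ℕ} {c : ℝ} (h0 : a 0 ≤ c) (hN : c < a N) :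
    ∃ i < N, a i ≤ c ∧ c < a (i + 1) := by
  induction N with
  | zero => exact absurd hN (not_lt.2 h0)
  | succ N ih =>
    rcases lt_or_ge c (a N) with h | h
    · obtain ⟨i, hi, h1⟩ := ih h
      exact ⟨i, hi.trans N.lt_succ_self, h1⟩
    · exact ⟨N, N.lt_succ_self, h, hN⟩

theorem lt_abs_sub_of_lt_norm {c z s : ℝ} (h : s < ‖(c : UnitAddCircle) - (z : UnitAddCircle)‖) :
    s < |c - z| := by
  rw [← AddCircle.coe_sub] at h
  exact h.trans_le (UnitAddCircle.norm_coe_le_abs _)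

/-- Symmetric increments of a piecewise absolutely continuous function are controlled by an
absolutely continuous measure, away from finitely many points. -/
theorem IsPiecewiseAC.exists_measure {g : UnitAddCircle → ℝ} (hg : IsPiecewiseAC g) :
    ∃ (Γ : Finset UnitAddCircle) (ν : Measure ℝ), (0 : UnitAddCircle) ∈ Γ ∧
      IsFiniteMeasure ν ∧ ν ≪ volume.restrict (Ioc 0 1) ∧
      ∀ c s : ℝ, 0 ≤ c → c < 1 → 0 < s → (∀ γ ∈ Γ, s < ‖(c : UnitAddCircle) - γ‖) →
        |circleLift g (c + s) - circleLift g (c - s)| ≤ ν.real (Icc (c - s) (c + s)) := by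
  classical
  obtain ⟨N, a, ha0, haN, ha⟩ := hg
  have hmono : ∀ i ≤ N, 0 ≤ a i := by
    intro i hi
    induction i with
    | zero => exact ha0.ge
    | succ i ih => exact (ih (by omega)).trans (ha i (by omega)).1.le
  have hmono' : ∀ k ≤ N, a (N - k) ≤ 1 := by
    intro k hk
    induction k with
    | zero => exact haN.le
    | succ k ih =>
      have := (ha (N - (k + 1)) (by omega)).1.le
      rw [show N - (k + 1) + 1 = N - k by omega] at this
      exact this.trans (ih (by omega))
  have hle1 : ∀ i ≤ N, a i ≤ 1 := by
    intro i hi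
    have := hmono' (N - i) (by omega)
    rwa [show N - (N - i) = i by omega] at this
  have hν : ∀ i : ℕ, ∃ ν : Measure ℝ, IsFiniteMeasure ν ∧ ν ≪ volume.restrict (Ioc 0 1) ∧
      (i < N → ∀ x y, a i < x → x ≤ y → y < a (i + 1) →
        |circleLift g y - circleLift g x| ≤ ν.real (Icc x y)) := by
    intro i
    by_cases hi : i < N
    · obtain ⟨hlt, G, hG, hgG⟩ := ha i hi
      obtain ⟨ν, hfin, hac, hν⟩ := hG.exists_measure hlt.le
      refine ⟨ν, hfin, hac.trans (Measure.absolutelyContinuous_of_le (Measure.restrict_mono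
        (Ioc_subset_Ioc (hmono i hi.le) (hle1 _ hi)) le_rfl)), fun _ x y hx hxy hy => ?_⟩
      rw [hgG ⟨hx.trans_le hxy, hy⟩, hgG ⟨hx, hxy.trans_lt hy⟩]
      exact hν x y hx.le hxy hy.le
    · exact ⟨0, inferInstance, Measure.AbsolutelyContinuous.zero _, fun h => absurd h hi⟩
  choose ν hfin hac hν using hν
  have hfin' : IsFiniteMeasure (∑ i ∈ Finset.range N, ν i) := inferInstance
  refine ⟨(Finset.range (N + 1)).image fun i => (a i : UnitAddCircle),
    ∑ i ∈ Finset.range N, ν i, Finset.mem_image.2 ⟨0, by simp, by simp [ha0]⟩, hfin', ?_, ?_⟩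
  · intro E hE
    rw [Measure.finsetSum_apply]
    exact Finset.sum_eq_zero fun i _ => hac i hE
  · intro c s hc0 hc1 hs hΓ
    obtain ⟨i, hi, hic, hci⟩ := exists_mem_Ico_of_partition (a := a) (N := N) (c := c)
      (by rw [ha0]; exact hc0) (by rw [haN]; exact hc1)
    -- Distance more than `s` from both ends keeps `[c - s, c + s]` inside one open piece.
    have h1 := lt_abs_sub_of_lt_norm (hΓ _ (Finset.mem_image.2 ⟨i, by simp; omega, rfl⟩))
    have h2 := lt_abs_sub_of_lt_norm (hΓ _ (Finset.mem_image.2 ⟨i + 1, by simp; omega, rfl⟩))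
    rw [abs_of_nonneg (by linarith)] at h1
    rw [abs_of_neg (by linarith)] at h2
    refine (hν i hi (c - s) (c + s) (by linarith) (by linarith) (by linarith)).trans ?_
    refine ENNReal.toReal_mono (measure_ne_top _ _) ?_
    rw [Measure.finsetSum_apply]
    exact Finset.single_le_sum (f := fun i => ν i (Icc (c - s) (c + s))) (fun _ _ => zero_le)
      (Finset.mem_range.2 hi)

/-- Shrink `ε` so that the tail is at most half of the least of `d 0, …, d M`. If `N ≤ M`, then `d
N` would belong to the tail and be at most half of itself. -/
theorem TailCondition.exists_gt {d : ℕ → ℝ} (h : TailCondition d) (hd : ∀ i, 0 < d i)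
    (hs : Summable d) {ε : ℝ} (hε : 0 < ε) (M : ℕ) :
    ∃ N, M < N ∧ ∀ i < N, ∑' k, d (N + k) ≤ ε * d i := by
  obtain ⟨i₀, -, hmin⟩ := Finset.exists_min_image (Finset.range (M + 1)) d ⟨0, by simp⟩
  obtain ⟨N, hN, hle⟩ := h (min ε (d i₀ / (2 * d 0)))
    (lt_min hε (div_pos (hd _) (mul_pos two_pos (hd 0))))
  refine ⟨N, ?_, fun i hi => (hle i hi).trans
    (mul_le_mul_of_nonneg_right (min_le_left _ _) (hd i).le)⟩
  by_contra hNM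
  have h1 : d N ≤ ∑' k, d (N + k) := by
    have hs' : Summable fun k => d (N + k) := by
      simpa only [add_comm] using (summable_nat_add_iff N).2 hs
    simpa using hs'.le_tsum 0 fun k _ => (hd _).le
  have h2 := hle 0 hN
  have h3 : min ε (d i₀ / (2 * d 0)) * d 0 ≤ d i₀ / (2 * d 0) * d 0 :=
    mul_le_mul_of_nonneg_right (min_le_right _ _) (hd 0).le
  have h4 : d i₀ / (2 * d 0) * d 0 = d i₀ / 2 := by
    have := (hd 0).ne'; field_simp
  have h5 := hmin N (by simp; omega)
  linarith [hd i₀]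

/-- The measure with atoms of weights `d i` at the points `b i`. -/
theorem exists_sum_dirac {b : ℕ → UnitAddCircle} {d : ℕ → ℝ} (hd : ∀ i, 0 ≤ d i)
    (hs : Summable d) :
    ∃ τ : Measure UnitAddCircle, IsFiniteMeasure τ ∧ ∀ E, MeasurableSet E →
      τ.real E = ∑' i, E.indicator (fun _ => d i) (b i) := by
  set τ : Measure UnitAddCircle :=
    Measure.sum fun i => ENNReal.ofReal (d i) • Measure.dirac (b i) with hτ
  have happly : ∀ E, MeasurableSet E →
      τ E = ∑' i, ENNReal.ofReal (E.indicator (fun _ => d i) (b i)) := by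
    intro E hE
    rw [hτ, Measure.sum_apply _ hE]
    refine tsum_congr fun i => ?_
    rw [Measure.smul_apply, Measure.dirac_apply' _ hE, smul_eq_mul]
    by_cases h : b i ∈ E <;> simp [h]
  have hnn : ∀ (E : Set UnitAddCircle) i, 0 ≤ E.indicator (fun _ => d i) (b i) :=
    fun E i => indicator_nonneg (fun _ _ => hd i) _
  have hsE : ∀ E : Set UnitAddCircle, Summable fun i => E.indicator (fun _ => d i) (b i) :=
    fun E => Summable.of_nonneg_of_le (hnn E)
      (fun i => indicator_le_self' (f := fun _ => d i) (fun _ _ => hd i) _) hs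
  refine ⟨τ, ⟨?_⟩, fun E hE => ?_⟩
  · rw [happly _ MeasurableSet.univ, ← ENNReal.ofReal_tsum_of_nonneg (hnn _) (hsE _)]
    exact ENNReal.ofReal_lt_top
  · rw [Measure.real, happly E hE, ← ENNReal.ofReal_tsum_of_nonneg (hnn _) (hsE _),
      ENNReal.toReal_ofReal (tsum_nonneg (hnn E))]

theorem ite_lt_sub_ite_lt {L R B : ℝ} (D : ℝ) (h : L ≤ R) :
    ((if B < R then D else 0) - if B < L then D else 0) = if B ∈ Ico L R then D else 0 := by
  rcases lt_or_ge B L with h1 | h1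
  · simp [h1, h1.trans_le h]
  · simp [mem_Ico, h1, not_lt.2 h1]

section Enumerated

variable {f : UnitAddCircle → ℝ} {β : ℕ → ℚ}

/-- Symmetric increments of a function without singular part: they are given by the first `N`
jumps, up to an error controlled by an absolutely continuous measure and the remaining jumps. -/
theorem IsBVaj.exists_measure (hf : IsBVaj f)
    (hdisc : {x : UnitAddCircle | ¬ ContinuousAt f x} =
      range (fun i : ℕ => (((β i : ℚ) : ℝ) : UnitAddCircle)))
    (hβ : ∀ i j, i ≠ j → ∀ z : ℤ, β i - β j ≠ z)
    (hpos : ∀ i, 0 < circleJump f (β i)) (N : ℕ) :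
    ∃ (ν : Measure ℝ) (τ : Measure UnitAddCircle), IsFiniteMeasure ν ∧ IsFiniteMeasure τ ∧
      ν ≪ volume.restrict (Ioc 0 1) ∧ τ.real univ = ∑' k, circleJump f (β (N + k)) ∧
      ∀ c s : ℝ, 0 < s → s < c → c + s < 1 →
        (∀ i : Fin N, (c : UnitAddCircle) = ((β i : ℝ) : UnitAddCircle) ∨
          s < ‖(c : UnitAddCircle) - ((β i : ℝ) : UnitAddCircle)‖) →
        |circleLift f (c + s) - circleLift f (c - s) -
          ∑ i : Fin N, if (c : UnitAddCircle) = ((β i : ℝ) : UnitAddCircle)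
            then circleJump f (β i) else 0| ≤
          ν.real (Icc (c - s) (c + s)) + τ.real (Metric.closedBall (c : UnitAddCircle) s) := by
  classical
  obtain ⟨ν, hνfin, hνac, hν⟩ := hf.noSingularPart.exists_measure zero_le_one
  have hsum := hf.summable_circleJump_comp hdisc hβ hpos
  have hsumN : Summable fun k => circleJump f (β (N + k)) := by
    simpa only [add_comm] using (summable_nat_add_iff N).2 hsum
  obtain ⟨τ, hτfin, hτ⟩ := exists_sum_dirac (b := fun k => ((β (N + k) : ℝ) : UnitAddCircle))
    (fun k => (hpos (N + k)).le) hsumN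
  refine ⟨ν, τ, hνfin, hτfin, hνac, by rw [hτ _ MeasurableSet.univ]; simp, ?_⟩
  intro c s hs hsc hcs hmain
  set d : ℕ → ℝ := fun i => circleJump f (β i) with hd
  have hd0 : ∀ i, 0 ≤ d i := fun i => (hpos i).le
  set b : ℕ → ℝ := fun i => Int.fract (β i : ℝ) with hb
  have hsx : ∀ x, Summable fun i => if b i < x then d i else 0 := fun x =>
    Summable.of_nonneg_of_le (fun i => by split_ifs; exacts [hd0 i, le_rfl])
      (fun i => by split_ifs; exacts [le_rfl, hd0 i]) hsum
  set e : ℕ → ℝ := fun i => if b i ∈ Ico (c - s) (c + s) then d i else 0 with he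
  have he_eq : ∀ i, (if b i < c + s then d i else 0) - (if b i < c - s then d i else 0) = e i := by
    exact fun i => ite_lt_sub_ite_lt _ (by linarith)
  have hse : Summable e := ((hsx (c + s)).sub (hsx (c - s))).congr he_eq
  have hJ : jumpPart f (c + s) - jumpPart f (c - s) = ∑' i, e i := by
    rw [jumpPart_eq_tsum hdisc hβ hcs.le, jumpPart_eq_tsum hdisc hβ (by linarith),
      ← (hsx (c + s)).tsum_sub (hsx (c - s))]
    exact tsum_congr he_eq
  have hnorm : ∀ i, b i ∈ Ico (c - s) (c + s) →
      ‖(c : UnitAddCircle) - ((β i : ℝ) : UnitAddCircle)‖ ≤ s := by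
    intro i hi
    rw [← coe_fract_eq (β i : ℝ), ← AddCircle.coe_sub]
    exact (UnitAddCircle.norm_coe_le_abs _).trans
      (abs_sub_le_iff.2 ⟨by linarith [hi.1], by linarith [hi.2]⟩)
  -- A main jump lies in the window only if it sits at the centre; all other jumps in the window
  -- belong to the tail and are charged to `τ`.
  have hmain_eq : ∀ i : Fin N, (if (c : UnitAddCircle) = ((β i : ℝ) : UnitAddCircle)
      then d i else 0) = e i := by
    intro i
    rcases hmain i with h | h
    · have hbc : b i = c := by
        rw [← coe_fract_eq (β i : ℝ)] at h
        exact ((AddCircle.coe_eq_coe_iff_of_mem_Ico (p := (1 : ℝ)) (a := 0)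
          ⟨by linarith, by linarith⟩
          ⟨Int.fract_nonneg _, by simpa using Int.fract_lt_one _⟩).1 h).symm
      rw [if_pos h, he]
      simp only [hbc]
      rw [if_pos ⟨by linarith, by linarith⟩]
    · have hnot : b i ∉ Ico (c - s) (c + s) := fun hi => absurd (hnorm i hi) (not_le.2 h)
      rw [if_neg, he]
      · simp only; rw [if_neg hnot]
      · intro h0
        rw [h0, sub_self, norm_zero] at h
        linarith
  have htail : ∑' k, e (N + k) ≤ τ.real (Metric.closedBall (c : UnitAddCircle) s) := by
    rw [hτ _ measurableSet_closedBall]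
    have hseN : Summable fun k => e (N + k) := by
      simpa only [add_comm] using (summable_nat_add_iff N).2 hse
    refine hseN.tsum_le_tsum (fun k => ?_) (Summable.of_nonneg_of_le
      (fun k => indicator_nonneg (fun _ _ => hd0 _) _)
      (fun k => indicator_le_self' (f := fun _ => d (N + k)) (fun _ _ => hd0 _) _) hsumN)
    simp only [he]
    split_ifs with h
    · rw [indicator_of_mem]
      rw [Metric.mem_closedBall, dist_comm, dist_eq_norm]
      exact hnorm _ h
    · exact indicator_nonneg (fun _ _ => hd0 _) _
  have htail0 : 0 ≤ ∑' k, e (N + k) := tsum_nonneg fun k => by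
    simp only [he]; split_ifs; exacts [hd0 _, le_rfl]
  have hsplit : ∑' i, e i = ∑ i : Fin N, e i + ∑' k, e (N + k) := by
    rw [← hse.sum_add_tsum_nat_add N, Finset.sum_range]
    simp only [add_comm]
  have hA := hν (c - s) (c + s) (by linarith) (by linarith) hcs.le
  rw [Finset.sum_congr rfl fun i _ => hmain_eq i]
  have key : circleLift f (c + s) - circleLift f (c - s) - ∑ i : Fin N, e i =
      ((circleLift f (c + s) - jumpPart f (c + s)) - (circleLift f (c - s) - jumpPart f (c - s))) +
        ∑' k, e (N + k) := by
    linarith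
  rw [key]
  refine (abs_add_le _ _).trans (add_le_add hA ?_)
  rwa [abs_of_nonneg htail0]

/-- The admissible error `3δ/8` is split into `δ/8` for the absolutely continuous parts on small
sets and `δ/4` for the whole mass of the remaining jumps. -/
theorem not_isCohomologous_of_tailCondition {α : ℝ} (hα : Irrational α)
    (hbpq : HasBoundedPartialQuotients α) (hf : IsBVaj f)
    (hdisc : {x : UnitAddCircle | ¬ ContinuousAt f x} =
      range (fun i : ℕ => (((β i : ℚ) : ℝ) : UnitAddCircle)))
    (hβ : ∀ i j, i ≠ j → ∀ z : ℤ, β i - β j ≠ z)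
    (hpos : ∀ i, 0 < circleJump f (β i)) (htail : TailCondition fun i => circleJump f (β i))
    {g : UnitAddCircle → ℝ} (hg : IsPiecewiseAC g) : ¬ IsCohomologous α f g := by
  classical
  obtain ⟨c, hc, hcα⟩ := hbpq.exists_le_norm_nat_mul hα
  obtain ⟨Γ, νg, h0Γ, hνgfin, hνgac, hνg⟩ := hg.exists_measure
  obtain ⟨N, hN, hNtail⟩ := htail.exists_gt hpos (hf.summable_circleJump_comp hdisc hβ hpos)
    (ε := 1 / 4) (by norm_num) Γ.card
  obtain ⟨νf, τ, hνffin, hτfin, hνfac, hτuniv, hνf⟩ := hf.exists_measure hdisc hβ hpos N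
  have hNpos : 0 < N := lt_of_le_of_lt (Nat.zero_le _) hN
  obtain ⟨i₀, hi₀, hmin⟩ := Finset.exists_min_image (Finset.range N)
    (fun i => circleJump f (β i)) ⟨0, by simpa using hNpos⟩
  set δ : ℝ := circleJump f (β i₀) with hδ
  have hδpos : 0 < δ := hpos i₀
  set ν : Measure UnitAddCircle := (νf + νg).map ((↑) : ℝ → UnitAddCircle) with hν
  have hνac : ν ≪ volume := map_coe_absolutelyContinuous (hνfac.add_left hνgac)
  obtain ⟨ω, hω, hωle⟩ := Measure.AbsolutelyContinuous.exists_pos_measureReal_le hνac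
    (η := δ / 8) (by positivity)
  refine not_isCoboundary_of_increments hc hcα (fun i : Fin N => β i)
    (fun i j hij => hβ i j fun h => hij (Fin.ext h)) (d := fun i => circleJump f (β i)) hδpos
    (fun i => hmin i (Finset.mem_range.2 i.2)) hN (m := ν + τ) ?_ hω ?_
  · intro x s hs hxΓ hxβ
    obtain ⟨y, rfl⟩ := QuotientAddGroup.mk_surjective x
    change (∀ γ ∈ Γ, s < ‖(y : UnitAddCircle) - γ‖) at hxΓ
    change (∀ i : Fin N, (y : UnitAddCircle) = _ ∨ s < ‖(y : UnitAddCircle) - _‖) at hxβ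
    change |f ((y : UnitAddCircle) + s) - g ((y : UnitAddCircle) + s) -
      (f ((y : UnitAddCircle) - s) - g ((y : UnitAddCircle) - s)) -
      ∑ i : Fin N, if (y : UnitAddCircle) = ((β i : ℝ) : UnitAddCircle)
            then circleJump f (β i) else 0| ≤ (ν + τ).real (Metric.closedBall (y : UnitAddCircle) s)
    rw [← coe_fract_eq y] at hxΓ hxβ ⊢
    set c := Int.fract y
    have hc0 : 0 ≤ c := Int.fract_nonneg y
    have hc1 : c < 1 := Int.fract_lt_one y
    -- As `0 ∈ Γ`, the window `[c - s, c + s]` does not wrap around the circle.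
    have h0 := hxΓ 0 h0Γ
    have hsc : s < c := by
      have := lt_abs_sub_of_lt_norm (z := 0) (by simpa using h0)
      rwa [sub_zero, abs_of_nonneg hc0] at this
    have hcs : c + s < 1 := by
      have := lt_abs_sub_of_lt_norm (c := c) (z := 1) (by
        rwa [AddCircle.coe_period])
      rw [abs_of_neg (by linarith)] at this
      linarith
    have h1 := hνf c s hs hsc hcs hxβ
    have h2 := hνg c s hc0 hc1 hs hxΓ
    have h3 : (νf + νg).real (Icc (c - s) (c + s)) ≤ ν.real (Metric.closedBall (c : UnitAddCircle) s) :=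
      measureReal_Icc_le_map_coe c s
    rw [measureReal_add_apply] at h3 ⊢
    simp only [circleLift, AddCircle.coe_add, AddCircle.coe_sub] at h1 h2
    rw [sub_sub_sub_comm, sub_right_comm]
    refine (abs_sub _ _).trans ?_
    linarith
  · intro E hE hEω
    rw [measureReal_add_apply]
    have h1 := hωle E hE hEω
    have h2 : τ.real E ≤ τ.real univ := measureReal_mono (subset_univ _)
    have h3 := hNtail i₀ (Finset.mem_range.1 hi₀)
    rw [hτuniv] at h2
    linarith

end Enumerated

/-! ### An explicit example: the sawtooth series. -/

theorem boundedVariationOn_of_abs_sub_le {f G : ℝ → ℝ} {s : Set ℝ} (hG : BoundedVariationOn G s)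
    (h : ∀ x ∈ s, ∀ y ∈ s, x ≤ y → |f y - f x| ≤ |G y - G x|) : BoundedVariationOn f s := by
  refine ne_top_of_le_ne_top hG (iSup_le ?_)
  rintro ⟨n, u, hu, hus⟩
  refine le_trans (Finset.sum_le_sum fun i _ => ?_) (eVariationOn.sum_le hu hus)
  rw [edist_dist, edist_dist, Real.dist_eq, Real.dist_eq]
  exact ENNReal.ofReal_le_ofReal (h _ (hus i) _ (hus (i + 1)) (hu i.le_succ))

/-- The superposition of sawtooth functions `x ↦ {b i - x}` with weights `d i`. -/
noncomputable def sawtoothSeries (d : ℕ → ℝ) (b : ℕ → ℝ) (x : UnitAddCircle) : ℝ :=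
  ∑' i, d i * (AddCircle.equivIco 1 0 ((b i : UnitAddCircle) - x) : ℝ)

section Sawtooth

variable {d : ℕ → ℝ} {b : ℕ → ℝ}

theorem circleLift_sawtoothSeries (d b : ℕ → ℝ) (x : ℝ) :
    circleLift (sawtoothSeries d b) x = ∑' i, d i * Int.fract (b i - x) := by
  refine tsum_congr fun i => ?_
  rw [← AddCircle.coe_sub]
  congr 1
  simpa using AddCircle.coe_equivIco_mk_apply (p := (1 : ℝ)) (b i - x)

theorem norm_mul_fract_le (hd : ∀ i, 0 < d i) (i : ℕ) (x : ℝ) :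
    ‖d i * Int.fract x‖ ≤ d i := by
  rw [Real.norm_of_nonneg (mul_nonneg (hd i).le (Int.fract_nonneg x))]
  exact mul_le_of_le_one_right (hd i).le (Int.fract_lt_one x).le

theorem continuousWithinAt_fract_sub (c x : ℝ) :
    ContinuousWithinAt (fun y => Int.fract (c - y)) (Iic x) x := by
  have h1 : Tendsto (fun y : ℝ => c - y) (𝓝[≤] x) (𝓝[≥] (c - x)) := by
    refine tendsto_nhdsWithin_of_tendsto_nhds_of_eventually_within _ ?_ ?_
    · exact ((by fun_prop : Continuous fun y : ℝ => c - y).tendsto x).mono_left nhdsWithin_le_nhds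
    · filter_upwards [self_mem_nhdsWithin] with y hy
      simp only [mem_Iic, mem_Ici] at *; linarith
  have h2 : ContinuousWithinAt (Int.fract : ℝ → ℝ) (Ici (c - x)) (c - x) := by
    by_cases h : c - x = ⌊c - x⌋
    · have := tendsto_fract_right' (α := ℝ) ⌊c - x⌋
      rw [← h] at this
      rw [ContinuousWithinAt]
      convert this using 2
      rw [Int.fract]; linarith
    · exact (continuousAt_fract h).continuousWithinAt
  exact Tendsto.comp h2 h1

theorem tendsto_fract_sub_self (c : ℝ) :
    Tendsto (fun y => Int.fract (c - y)) (𝓝[>] c) (𝓝 1) := by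
  have h1 : Tendsto (fun y : ℝ => c - y) (𝓝[>] c) (𝓝[<] ((0 : ℤ) : ℝ)) := by
    refine tendsto_nhdsWithin_of_tendsto_nhds_of_eventually_within _ ?_ ?_
    · have := (by fun_prop : Continuous fun y : ℝ => c - y).tendsto c
      simpa using this.mono_left nhdsWithin_le_nhds
    · filter_upwards [self_mem_nhdsWithin] with y hy
      simpa using hy
  exact (tendsto_fract_left' (0 : ℤ)).comp h1

theorem sawtoothSeries_leftContinuous (hd : ∀ i, 0 < d i) (hs : Summable d) (x : ℝ) :
    ContinuousWithinAt (circleLift (sawtoothSeries d b)) (Iic x) x := by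
  rw [ContinuousWithinAt, circleLift_sawtoothSeries,
    funext fun y => circleLift_sawtoothSeries d b y]
  exact tendsto_tsum_of_dominated_convergence hs
    (fun i => (continuousWithinAt_fract_sub (b i) x).const_mul (d i))
    (Eventually.of_forall fun y i => norm_mul_fract_le hd i _)

theorem continuousAt_fract_sub {c x : ℝ} (h : ∀ z : ℤ, c - x ≠ z) :
    ContinuousAt (fun y => Int.fract (c - y)) x :=
  ContinuousAt.comp (g := Int.fract) (continuousAt_fract (h _))
    (by fun_prop : Continuous fun y : ℝ => c - y).continuousAt

/-- By dominated convergence limits pass through the series; only the `k`-th term is discontinuous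
at `b k`, with right limit `d k` and value `0`. -/
theorem tendsto_circleLift_sawtoothSeries_right (hd : ∀ i, 0 < d i) (hs : Summable d)
    (hb : ∀ i j, i ≠ j → ∀ z : ℤ, b i - b j ≠ z) (k : ℕ) :
    Tendsto (circleLift (sawtoothSeries d b)) (𝓝[>] (b k))
      (𝓝 (∑' i, (d i * Int.fract (b i - b k) + if i = k then d k else 0))) := by
  rw [funext fun y => circleLift_sawtoothSeries d b y]
  have hlim : ∀ i, Tendsto (fun y => d i * Int.fract (b i - y)) (𝓝[>] (b k))
      (𝓝 (d i * Int.fract (b i - b k) + if i = k then d k else 0)) := by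
    intro i
    by_cases hik : i = k
    · subst hik
      have h := (tendsto_fract_sub_self (b i)).const_mul (d i)
      rw [if_pos rfl, sub_self, Int.fract_zero, mul_zero, zero_add]
      rwa [mul_one] at h
    · rw [if_neg hik, add_zero]
      exact Tendsto.const_mul (d i) ((continuousAt_fract_sub (hb i k hik)).tendsto.mono_left
        nhdsWithin_le_nhds)
  exact tendsto_tsum_of_dominated_convergence hs hlim
    (Eventually.of_forall fun y i => norm_mul_fract_le hd i _)

theorem circleJump_sawtoothSeries (hd : ∀ i, 0 < d i) (hs : Summable d)
    (hb : ∀ i j, i ≠ j → ∀ z : ℤ, b i - b j ≠ z) (k : ℕ) :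
    circleJump (sawtoothSeries d b) (b k) = d k := by
  have hfr : Summable fun i => d i * Int.fract (b i - b k) :=
    Summable.of_norm_bounded hs fun i => norm_mul_fract_le hd i _
  have hite : HasSum (fun i => if i = k then d k else 0) (d k) := hasSum_ite_eq k (d k)
  have hleft : Function.leftLim (circleLift (sawtoothSeries d b)) (b k) =
      circleLift (sawtoothSeries d b) (b k) :=
    (sawtoothSeries_leftContinuous hd hs (b k)).leftLim_eq
  rw [circleJump, rightLim_eq_of_tendsto (tendsto_circleLift_sawtoothSeries_right hd hs hb k),
    hleft, circleLift_sawtoothSeries, hfr.tsum_add hite.summable, hite.tsum_eq,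
    add_sub_cancel_left]

theorem sawtoothSeries_continuousAt (hd : ∀ i, 0 < d i) (hs : Summable d) {x : UnitAddCircle}
    (hx : ∀ i, (b i : UnitAddCircle) ≠ x) : ContinuousAt (sawtoothSeries d b) x := by
  refine tendsto_tsum_of_dominated_convergence hs (fun i => Tendsto.const_mul (d i) ?_)
    (Eventually.of_forall fun y i => ?_)
  · have h1 : ContinuousAt (AddCircle.equivIco (1 : ℝ) 0) ((b i : UnitAddCircle) - x) :=
      AddCircle.continuousAt_equivIco (1 : ℝ) 0 (by simpa [sub_eq_zero] using hx i)
    exact (continuousAt_subtype_val.comp h1).comp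
      (f := fun y => (b i : UnitAddCircle) - y)
      (by fun_prop : Continuous fun y => (b i : UnitAddCircle) - y).continuousAt
  · have h := (AddCircle.equivIco (1 : ℝ) 0 ((b i : UnitAddCircle) - y)).2
    rw [Real.norm_of_nonneg (mul_nonneg (hd i).le h.1)]
    exact mul_le_of_le_one_right (hd i).le (by simpa using h.2.le)

theorem setOf_not_continuousAt_sawtoothSeries (hd : ∀ i, 0 < d i) (hs : Summable d)
    (hb : ∀ i j, i ≠ j → ∀ z : ℤ, b i - b j ≠ z) :
    {x : UnitAddCircle | ¬ ContinuousAt (sawtoothSeries d b) x} =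
      range fun i => (b i : UnitAddCircle) := by
  ext x
  simp only [mem_ofPred_eq, mem_range]
  constructor
  · intro h
    by_contra! hx
    exact h (sawtoothSeries_continuousAt hd hs hx)
  · rintro ⟨i, rfl⟩ h
    have h1 := circleJump_eq_zero_of_continuousAt_coe h
    rw [circleJump_sawtoothSeries hd hs hb] at h1
    exact (hd i).ne' h1

end Sawtooth

/-- On `[0, 1]` the fractional part of `b i - x` is `b i - x`, plus `1` when `b i < x`. Removing the
jump part thus leaves an affine function of slope `-∑ d i`, and the sum of jumps is `∑ d i > 0`. -/
theorem sawtoothSeries_isClassU {d : ℕ → ℝ} {β : ℕ → ℚ} (hd : ∀ i, 0 < d i) (hs : Summable d)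
    (hβ : ∀ i j, i ≠ j → ∀ z : ℤ, β i - β j ≠ z) (hβ0 : ∀ i, 0 < β i) (hβ1 : ∀ i, β i < 1) :
    IsClassU (sawtoothSeries d fun i => β i) := by
  classical
  set b : ℕ → ℝ := fun i => β i with hbdef
  have hb : ∀ i j, i ≠ j → ∀ z : ℤ, b i - b j ≠ z := fun i j hij z h =>
    hβ i j hij z (by simp only [hbdef] at h; exact_mod_cast h)
  have hb0 : ∀ i, 0 < b i := fun i => Rat.cast_pos.2 (hβ0 i)
  have hb1 : ∀ i, b i < 1 := fun i => by simp only [hbdef]; exact_mod_cast hβ1 i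
  set f := sawtoothSeries d b with hf
  have hfrb : ∀ i, Int.fract (b i) = b i := fun i => Int.fract_eq_self.2 ⟨(hb0 i).le, hb1 i⟩
  have hJ : ∀ x ≤ 1, jumpPart f x = ∑' i, if b i < x then d i else 0 := by
    intro x hx
    rw [jumpPart_eq_tsum (setOf_not_continuousAt_sawtoothSeries hd hs hb) hβ hx]
    refine tsum_congr fun i => ?_
    rw [show ((β i : ℚ) : ℝ) = b i from rfl, hfrb, circleJump_sawtoothSeries hd hs hb]
  have hsJ : ∀ x, Summable fun i => if b i < x then d i else 0 := fun x =>
    Summable.of_nonneg_of_le (fun i => by split_ifs; exacts [(hd i).le, le_rfl])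
      (fun i => by split_ifs; exacts [le_rfl, (hd i).le]) hs
  have hsdb : Summable fun i => d i * b i :=
    Summable.of_nonneg_of_le (fun i => mul_nonneg (hd i).le (hb0 i).le)
      (fun i => mul_le_of_le_one_right (hd i).le (hb1 i).le) hs
  have hsfr : ∀ x, Summable fun i => d i * Int.fract (b i - x) := fun x =>
    Summable.of_norm_bounded hs fun i => norm_mul_fract_le hd i _
  have hS0 : 0 ≤ ∑' i, d i := tsum_nonneg fun i => (hd i).le
  have haff : ∀ x ∈ Icc (0 : ℝ) 1, circleLift f x - jumpPart f x =
      ∑' i, d i * b i - (∑' i, d i) * x := by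
    intro x hx
    rw [circleLift_sawtoothSeries, hJ x hx.2, ← (hsfr x).tsum_sub (hsJ x), ← tsum_mul_right,
      ← hsdb.tsum_sub (hs.mul_right x)]
    refine tsum_congr fun i => ?_
    have h0 := hb0 i
    have h1 := hb1 i
    split_ifs with h
    · have : Int.fract (b i - x) = b i - x + 1 := by
        rw [Int.fract_eq_iff]
        exact ⟨by linarith [hx.2], by linarith, -1, by push_cast; ring⟩
      rw [this]; ring
    · have : Int.fract (b i - x) = b i - x :=
        Int.fract_eq_self.2 ⟨by linarith, by linarith [hx.1]⟩
      rw [this]; ring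
  have hac : AbsolutelyContinuousOnInterval (fun x => circleLift f x - jumpPart f x) 0 1 := by
    refine LipschitzOnWith.absolutelyContinuousOnInterval (K := (∑' i, d i).toNNReal) ?_
    rw [uIcc_of_le zero_le_one]
    refine LipschitzOnWith.of_dist_le_mul fun x hx y hy => le_of_eq ?_
    simp only [haff x hx, haff y hy, Real.dist_eq, Real.coe_toNNReal _ hS0]
    rw [show ∀ A S : ℝ, A - S * x - (A - S * y) = S * (y - x) by intros; ring, abs_mul,
      abs_of_nonneg hS0, abs_sub_comm]
  have hJmono : ∀ x ∈ Icc (0 : ℝ) 1, ∀ y ∈ Icc (0 : ℝ) 1, x ≤ y → jumpPart f x ≤ jumpPart f y := by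
    intro x hx y hy hxy
    rw [hJ x hx.2, hJ y hy.2]
    refine (hsJ x).tsum_le_tsum (fun i => ?_) (hsJ y)
    split_ifs
    exacts [le_rfl, by linarith, (hd i).le, le_rfl]
  have hbv : BoundedVariationOn (circleLift f) (Icc 0 1) := by
    have hmono : MonotoneOn (fun x => jumpPart f x + (∑' i, d i) * x) (Icc 0 1) :=
      fun x hx y hy hxy => add_le_add (hJmono x hx y hy hxy) (mul_le_mul_of_nonneg_left hxy hS0)
    refine boundedVariationOn_of_abs_sub_le (G := fun x => jumpPart f x + (∑' i, d i) * x)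
      (hmono.boundedVariationOn (C := |jumpPart f 0| + |jumpPart f 1 + ∑' i, d i|) ?_) ?_
    · intro x hx
      have h0 := hmono (left_mem_Icc.2 zero_le_one) hx hx.1
      have h1 := hmono hx (right_mem_Icc.2 zero_le_one) hx.2
      simp only [mul_zero, add_zero, mul_one] at h0 h1
      refine abs_le.2 ⟨?_, ?_⟩
      · linarith [neg_abs_le (jumpPart f 0), abs_nonneg (jumpPart f 1 + ∑' i, d i)]
      · linarith [le_abs_self (jumpPart f 1 + ∑' i, d i), abs_nonneg (jumpPart f 0)]
    · intro x hx y hy hxy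
      have h1 := haff x hx
      have h2 := haff y hy
      have h3 := hJmono x hx y hy hxy
      have h4 := mul_le_mul_of_nonneg_left hxy hS0
      refine le_trans ?_ (le_abs_self _)
      refine abs_le.2 ⟨?_, ?_⟩ <;> linarith
  refine ⟨⟨⟨hbv, sawtoothSeries_leftContinuous hd hs⟩, hac⟩, ?_⟩
  have hS : sumOfJumps f = ∑' i, d i := by
    change jumpPart f 1 = _
    rw [hJ 1 le_rfl]
    exact tsum_congr fun i => if_pos (hb1 i)
  rw [hS]
  exact (hs.tsum_pos (fun i => (hd i).le) 0 (hd 0)).ne'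

/-- Comparison with a geometric series of ratio `1 / (N + 1)` bounds the tail by `1 / N` times `1 /
N!`, the smallest of the first `N` terms. -/
theorem tailCondition_inv_factorial : TailCondition fun i => ((i + 1).factorial : ℝ)⁻¹ := by
  intro ε hε
  obtain ⟨M, hM⟩ := exists_nat_one_div_lt hε
  refine ⟨M + 1, by omega, fun i hi => ?_⟩
  set N := M + 1 with hN
  have hNpos : (0 : ℝ) < N := by exact_mod_cast M.succ_pos
  have hfpos : (0 : ℝ) < N.factorial := by exact_mod_cast N.factorial_pos
  set r : ℝ := ((N : ℝ) + 1)⁻¹ with hr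
  have hr0 : 0 ≤ r := by positivity
  have hr1 : r < 1 := inv_lt_one_of_one_lt₀ (by linarith)
  have hgeo : HasSum (fun k => (N.factorial : ℝ)⁻¹ * r * r ^ k)
      ((N.factorial : ℝ)⁻¹ * r * (1 - r)⁻¹) := (hasSum_geometric_of_lt_one hr0 hr1).mul_left _
  have hterm : ∀ k, (((N + k + 1).factorial : ℝ))⁻¹ ≤ (N.factorial : ℝ)⁻¹ * r * r ^ k := by
    intro k
    have h1 : N.factorial * (N + 1) ^ (k + 1) ≤ (N + (k + 1)).factorial :=
      Nat.factorial_mul_pow_le_factorial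
    have h2 : (N.factorial : ℝ) * ((N : ℝ) + 1) ^ (k + 1) ≤ ((N + k + 1).factorial : ℝ) := by
      rw [add_assoc]; exact_mod_cast h1
    calc (((N + k + 1).factorial : ℝ))⁻¹ ≤ ((N.factorial : ℝ) * ((N : ℝ) + 1) ^ (k + 1))⁻¹ :=
          inv_anti₀ (by positivity) h2
      _ = _ := by rw [hr, mul_inv, ← inv_pow, pow_succ]; ring
  have hsum : Summable fun k => (((N + k + 1).factorial : ℝ))⁻¹ :=
    Summable.of_nonneg_of_le (fun k => by positivity) hterm hgeo.summable
  have hle : ∑' k, (((N + k + 1).factorial : ℝ))⁻¹ ≤ (N.factorial : ℝ)⁻¹ * r * (1 - r)⁻¹ := by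
    rw [← hgeo.tsum_eq]; exact hsum.tsum_le_tsum hterm hgeo.summable
  have hval : (N.factorial : ℝ)⁻¹ * r * (1 - r)⁻¹ = (1 / N) * (N.factorial : ℝ)⁻¹ := by
    have : 1 - r = N * r := by rw [hr]; field_simp; ring
    rw [this, hr]; field_simp
  have hεN : 1 / (N : ℝ) ≤ ε := by rw [hN]; push_cast; exact hM.le
  have hfi : (N.factorial : ℝ)⁻¹ ≤ ((i + 1).factorial : ℝ)⁻¹ := by
    have : (i + 1).factorial ≤ N.factorial := Nat.factorial_le hi
    exact inv_anti₀ (by positivity) (by exact_mod_cast this)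
  calc ∑' k, (((N + k + 1).factorial : ℝ))⁻¹ ≤ (1 / N) * (N.factorial : ℝ)⁻¹ := hle.trans_eq hval
    _ ≤ ε * ((i + 1).factorial : ℝ)⁻¹ := by gcongr

theorem summable_inv_factorial_succ : Summable fun i : ℕ => ((i + 1).factorial : ℝ)⁻¹ := by
  have h : Summable fun i : ℕ => ((i.factorial : ℝ))⁻¹ := by
    simpa using Real.summable_pow_div_factorial 1
  exact (summable_nat_add_iff 1).2 h

theorem inv_add_two_sub_ne_int (i j : ℕ) (hij : i ≠ j) (z : ℤ) :
    ((i : ℚ) + 2)⁻¹ - ((j : ℚ) + 2)⁻¹ ≠ z := by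
  intro h
  have hpos : ∀ k : ℕ, 0 < ((k : ℚ) + 2)⁻¹ := fun k => by positivity
  have hlt : ∀ k : ℕ, ((k : ℚ) + 2)⁻¹ < 1 := fun k =>
    inv_lt_one_of_one_lt₀ (by linarith [(Nat.cast_nonneg k : (0 : ℚ) ≤ k)])
  have h1 : (z : ℚ) < 1 := by rw [← h]; linarith [hpos j, hlt i]
  have h2 : (-1 : ℚ) < z := by rw [← h]; linarith [hpos i, hlt j]
  have h3 : z = 0 := by
    have h1' : z < 1 := by exact_mod_cast h1
    have h2' : -1 < z := by exact_mod_cast h2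
    omega
  rw [h3, Int.cast_zero, sub_eq_zero, inv_inj, add_left_inj] at h
  exact hij (by exact_mod_cast h)

theorem mainTheorem5 (α : ℝ) (hα : Irrational α) (hbpq : HasBoundedPartialQuotients α) :
    (∀ (f : UnitAddCircle → ℝ) (β : ℕ → ℚ),
      IsClassU f →
      {x : UnitAddCircle | ¬ ContinuousAt f x} =
        Set.range (fun i : ℕ => (((β i : ℚ) : ℝ) : UnitAddCircle)) →
      (∀ i j : ℕ, i ≠ j → ¬ ∃ m n : ℤ, (β i : ℝ) - (β j : ℝ) = m + n * α) →
      (∀ i : ℕ, 0 < circleJump f (β i)) →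
      TailCondition (fun i : ℕ => circleJump f (β i)) →
      ∀ g : UnitAddCircle → ℝ, IsVonNeumann g → ¬ IsCohomologous α f g) ∧
    (∃ f : UnitAddCircle → ℝ, IsClassU f ∧
      ∀ g : UnitAddCircle → ℝ, IsVonNeumann g → ¬ IsCohomologous α f g) := by
  refine ⟨fun f β hf hdisc hβ hpos htail g hg => ?_, ?_⟩
  · refine not_isCohomologous_of_tailCondition hα hbpq hf.toIsBVaj hdisc (fun i j hij z hz => ?_)
      hpos htail hg.piecewiseAC
    -- An integer difference is the case of coefficient `0` at `α`.
    exact hβ i j hij ⟨z, 0, by rw [Int.cast_zero, zero_mul, add_zero]; exact_mod_cast hz⟩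
  · set β : ℕ → ℚ := fun i => ((i : ℚ) + 2)⁻¹ with hβdef
    set d : ℕ → ℝ := fun i => ((i + 1).factorial : ℝ)⁻¹ with hddef
    have hd : ∀ i, 0 < d i := fun i => by positivity
    have hβ : ∀ i j, i ≠ j → ∀ z : ℤ, β i - β j ≠ z := inv_add_two_sub_ne_int
    have hb : ∀ i j, i ≠ j → ∀ z : ℤ, (β i : ℝ) - (β j : ℝ) ≠ z := fun i j hij z h =>
      hβ i j hij z (by exact_mod_cast h)
    have hU := sawtoothSeries_isClassU hd summable_inv_factorial_succ hβ
      (fun i => by positivity)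
      (fun i => inv_lt_one_of_one_lt₀ (by linarith [(Nat.cast_nonneg i : (0 : ℚ) ≤ i)]))
    have hjump := circleJump_sawtoothSeries hd summable_inv_factorial_succ hb
    refine ⟨_, hU, fun g hg => not_isCohomologous_of_tailCondition hα hbpq hU.toIsBVaj
      (setOf_not_continuousAt_sawtoothSeries hd summable_inv_factorial_succ hb) hβ
      (fun i => by rw [hjump]; exact hd i) ?_ hg.piecewiseAC⟩
    rw [funext hjump]
    exact tailCondition_inv_factorial
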